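/- **Setting.** Fix an integer $K\ge 2$ and constants $A,B,\tau>0$ with $KA\le B<1$ and $\tau\le (1-B)/K$. Let $(\mathcal A,\mathcal Q)$ be a probability space. For each $u\in\mathcal A$ let $S_1(u),\dots,S_K(u):[0,1]\to[0,1]$ be similarities with scaling ratios $a(i,u)$, measurable in $u$, such that $A\le a(i,u)$ for all $i$, $\sum_i a(i,u)\le B$, and $\operatorname{dist}(S_i(u)[0,1],S_j(u)[0,1])\ge\tau$ for $i\ne j$. Let $\mathcal W=\{p\in\mathbb R^K: p(i)\ge 0,\ \sum_i p(i)=1\}$. A vector $p\in\mathcal W$ is called *valid* if $p(j)\neq 0$ for all $j$; a Borel probability measure $\mathcal R$ on $\mathcal W$ is called *admissible* if there is $t>0$ with $\int p(i)^{-t}\,d\mathcal R(p)<\infty$ for every $i$. Let $\boldsymbol\lambda=((u_n,p_n))_{n\ge1}$ be an i.i.d. sequence with law $\mathcal Q\times\mathcal R$ (scaling ratios and weights independent). The random measure $\mu_{\mathcal R}=\mu_{\boldsymbol\lambda}$ is the Borel probability measure on $[0,1]$ that gives each Moran interval $S_{i_1}(u_1)\circ\cdots\circ S_{i_n}(u_n)[0,1]$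 the mass $p_1(i_1)\cdots p_n(i_n)$. If $\mathcal R=\delta_p$ is a point mass, write $\mu_p$. A *dimension function* is a map $\Phi:(0,1)\to[0,\infty)$ such that $t^{1+\Phi(t)}$ decreases to $0$ as $t\downarrow0$ and, for some $T,C>0$, $(2t)^{1+\Phi(2t)}\le C\,t^{1+\Phi(t)}$ for $0<t<T$ (with $2t<1$); it is *large* if $\Phi(t)=H(t)\,\frac{\log|\log t|}{|\log t|}$ for all small $t$, with $H(t)\to\infty$ as $t\to0$. The upper $\Phi$-dimension $\overline{\dim}_\Phi\mu$ is the infimum of the $d\in\mathbb R$ for which there are $C_1,C_2>0$ with $\frac{\mu(B(x,R))}{\mu(B(x,r))}\le C_2\left(\frac Rr\right)^d$ for all $x\in\operatorname{supp}\mu$ and all $0<r<R^{1+\Phi(R)}\le R\le C_1$, $R<1$. **Statement.** For every admissible $\mathcal R$ there is a finite number, not depending on $\Phi$, that is the almost sure value of $\overline{\dim}_\Phi\mu_{\mathcal R}$ for every large dimension function $\Phi$. Moreover, there are a valid weight vector $p_0$ and a number $d\in\mathbb R$, not depending on $\Phi$, such that for every large dimension function $\Phi$ $$\overline{\dim}_\Phi\mu_{p_0}=d\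 \text{ almost surely, and}\qquad d=\inf_{p\text{ valid}}\overline{\dim}_\Phi\mu_p=\inf_{\mathcal R\text{ admissible}}\overline{\dim}_\Phi\mu_{\mathcal R},$$ where inside the infima $\overline{\dim}_\Phi$ denotes the almost sure value. -/

import Mathlib

open MeasureTheory Filter Topology
open scoped ENNReal

noncomputable section

/-! ## Dimension functions and upper dimensions of measures -/

/-- A dimension function: a map `Φ : (0,1) → [0,∞)` (values outside `(0,1)` are irrelevant) such
that `t ^ (1 + Φ t)` decreases to `0` as `t` decreases to `0` and is doubling near zero. -/
structure IsDimensionFunction (Φ : ℝ → ℝ) : Prop where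
  nonneg : ∀ t ∈ Set.Ioo (0 : ℝ) 1, 0 ≤ Φ t
  mono : MonotoneOn (fun t : ℝ => t ^ (1 + Φ t)) (Set.Ioo 0 1)
  tendsto_zero : Tendsto (fun t : ℝ => t ^ (1 + Φ t)) (𝓝[>] 0) (𝓝 0)
  doubling : ∃ T > 0, ∃ C > 0, ∀ t : ℝ, 0 < t → t < T → 2 * t < 1 →
    (2 * t) ^ (1 + Φ (2 * t)) ≤ C * t ^ (1 + Φ t)

/-- A large dimension function: `Φ t = H t * log |log t| / |log t|` for small `t`, where
`H t → ∞` as `t → 0`. -/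
structure IsLargeDimensionFunction (Φ : ℝ → ℝ) : Prop extends IsDimensionFunction Φ where
  large : ∃ H : ℝ → ℝ, Tendsto H (𝓝[>] 0) atTop ∧
    ∀ᶠ t in 𝓝[>] (0 : ℝ), Φ t = H t * (Real.log |Real.log t| / |Real.log t|)

/-- The upper `Φ`-dimension of a measure on a metric space: the infimum in `[-∞, ∞]` of the
exponents `d` for which there are `C₁, C₂ > 0` such that
`μ (B(x,R)) / μ (B(x,r)) ≤ C₂ (R / r) ^ d` for all `0 < r < R ^ (1 + Φ R) ≤ R ≤ C₁` and all `x` in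
the support of `μ`. The requirement `R < 1` says that `R` lies in the domain of `Φ`. -/
def upperPhiDim {X : Type*} [PseudoMetricSpace X] [MeasurableSpace X] (Φ : ℝ → ℝ)
    (μ : Measure X) : EReal :=
  sInf ((fun d : ℝ => (d : EReal)) '' {d : ℝ | ∃ C₁ > 0, ∃ C₂ > 0, ∀ r R : ℝ,
    0 < r → r < R ^ (1 + Φ R) → R ^ (1 + Φ R) ≤ R → R ≤ C₁ → R < 1 →
      ∀ x ∈ μ.support,
        μ.real (Metric.ball x R) / μ.real (Metric.ball x r) ≤ C₂ * (R / r) ^ d})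

/-! ## The random Moran model -/

/-- A family, indexed by a measurable space `𝒜`, of uniformly strongly separated iterated function
systems, each consisting of `K` similarities of `[0,1]`. -/
structure MoranFamily (K : ℕ) (𝒜 : Type*) [MeasurableSpace 𝒜] where
  /-- the lower bound for the scaling ratios -/
  A : ℝ
  /-- the upper bound for the sums of the scaling ratios -/
  B : ℝ
  /-- the separation constant -/
  τ : ℝ
  two_le : 2 ≤ K
  A_pos : 0 < A
  mul_A_le_B : K * A ≤ B
  B_lt_one : B < 1
  τ_pos : 0 < τ
  τ_le : τ ≤ (1 - B) / K
  /-- `ratio u i` is the scaling ratio of the `i`-th similarity of the system `u` -/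
  ratio : 𝒜 → Fin K → ℝ
  measurable_ratio : ∀ i, Measurable fun u => ratio u i
  A_le_ratio : ∀ u i, A ≤ ratio u i
  sum_ratio_le : ∀ u, ∑ i, ratio u i ≤ B
  /-- `map u i` is the `i`-th similarity of the system `u` -/
  map : 𝒜 → Fin K → unitInterval → unitInterval
  dist_map : ∀ u i x y, dist (map u i x) (map u i y) = ratio u i * dist x y
  separated : ∀ u i j, i ≠ j → ∀ x y, τ ≤ dist (map u i x) (map u j y)

/-- The space of all probability weight vectors of length `K`. -/
abbrev Weights (K : ℕ) : Type := stdSimplex ℝ (Fin K)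

/-- The valid single probabilities: weight vectors all of whose entries are nonzero. -/
def IsValidWeight {K : ℕ} (p : Weights K) : Prop := ∀ j, p j ≠ 0

/-- The distributions on the space of weight vectors which the model allows: the probability
measures `ℛ` such that for some `t > 0` the expectations of all `p(i) ^ (-t)` are finite (where
`0 ^ (-t) = ∞`). -/
def IsAdmissible {K : ℕ} (ℛ : Measure (Weights K)) : Prop :=
  IsProbabilityMeasure ℛ ∧
    ∃ t : ℝ, 0 < t ∧ ∀ i, ∫⁻ p, ENNReal.ofReal (p i) ^ (-t) ∂ℛ < ∞

/-- A weight vector as a probability distribution on the index set `{1, …, K}`. -/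
def weightPMF {K : ℕ} (p : Weights K) : PMF (Fin K) :=
  PMF.ofFintype (fun i => ENNReal.ofReal (p i)) (by
    have h : ∑ i, p i = 1 := p.2.2
    have h' := ENNReal.ofReal_sum_of_nonneg (s := Finset.univ) (f := fun i => p i)
      fun i _ => p.2.1 i
    rw [← h', h, ENNReal.ofReal_one])

namespace MoranFamily

variable {K : ℕ} {𝒜 : Type*} [MeasurableSpace 𝒜]

/-- The composition `S_{i₁}(ω₁) ∘ ⋯ ∘ S_{iₙ}(ωₙ)`; sequences are indexed from `0`. -/
def comp (F : MoranFamily K 𝒜) (ω : ℕ → 𝒜 × Weights K) (i : ℕ → Fin K) :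
    ℕ → unitInterval → unitInterval
  | 0 => id
  | n + 1 => comp F ω i n ∘ F.map (ω n).1 (i n)

/-- The step `n` Moran interval with address `i₁, …, iₙ`. -/
def moranInterval (F : MoranFamily K 𝒜) (ω : ℕ → 𝒜 × Weights K) (i : ℕ → Fin K) (n : ℕ) :
    Set unitInterval :=
  Set.range (F.comp ω i n)

/-- The point of the random Moran set with the infinite address `i`. -/
def coding (F : MoranFamily K 𝒜) (ω : ℕ → 𝒜 × Weights K) (i : ℕ → Fin K) : unitInterval :=
  limUnder atTop fun n => F.comp ω i n 0

/-- The random measure determined by the sequence `ω` of systems and weights: the distribution of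
the point with a random address whose digits are independent, the `n`-th one being chosen
according to the `n`-th weight vector. By `randomMeasure_moranInterval` it gives to each step `n`
Moran interval the product of the corresponding weights. -/
def randomMeasure (F : MoranFamily K 𝒜) (ω : ℕ → 𝒜 × Weights K) : Measure unitInterval :=
  (Measure.infinitePi fun n => (weightPMF (ω n).2).toMeasure).map (F.coding ω)

/-- In the independent case with distribution `𝒬` of the systems and distribution `ℛ` of the
weights, `α` is the almost sure upper `Φ`-dimension of the random measure; the sequence `ω` is
i.i.d. with law `𝒬 × ℛ`. -/
def HasUpperDim (F : MoranFamily K 𝒜) (𝒬 : Measure 𝒜) (ℛ : Measure (Weights K)) (Φ : ℝ → ℝ)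
    (α : EReal) : Prop :=
  ∀ᵐ ω ∂(Measure.infinitePi fun _ : ℕ => 𝒬.prod ℛ), upperPhiDim Φ (F.randomMeasure ω) = α

/-! ### The random measure satisfies its defining rule -/

theorem ratio_pos (F : MoranFamily K 𝒜) (u : 𝒜) (i : Fin K) : 0 < F.ratio u i :=
  F.A_pos.trans_le (F.A_le_ratio u i)

theorem ratio_le (F : MoranFamily K 𝒜) (u : 𝒜) (i : Fin K) : F.ratio u i ≤ F.B :=
  (Finset.single_le_sum (fun j _ => (F.ratio_pos u j).le) (Finset.mem_univ i)).trans
    (F.sum_ratio_le u)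

theorem dist_comp (F : MoranFamily K 𝒜) (ω : ℕ → 𝒜 × Weights K) (i : ℕ → Fin K) (n : ℕ)
    (x y : unitInterval) :
    dist (F.comp ω i n x) (F.comp ω i n y) =
      (∏ k ∈ Finset.range n, F.ratio (ω k).1 (i k)) * dist x y := by
  induction n generalizing x y with
  | zero => simp [comp]
  | succ n ih =>
    simp only [comp, Function.comp_apply]
    rw [ih, F.dist_map, Finset.prod_range_succ, mul_assoc]

theorem prod_ratio_pos (F : MoranFamily K 𝒜) (ω : ℕ → 𝒜 × Weights K) (i : ℕ → Fin K) (n : ℕ) :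
    0 < ∏ k ∈ Finset.range n, F.ratio (ω k).1 (i k) :=
  Finset.prod_pos fun _ _ => F.ratio_pos _ _

theorem continuous_comp (F : MoranFamily K 𝒜) (ω : ℕ → 𝒜 × Weights K) (i : ℕ → Fin K) (n : ℕ) :
    Continuous (F.comp ω i n) := by
  refine LipschitzWith.continuous (K := Real.toNNReal (∏ k ∈ Finset.range n,
    F.ratio (ω k).1 (i k))) (LipschitzWith.of_dist_le_mul fun x y => ?_)
  rw [F.dist_comp, Real.coe_toNNReal _ (F.prod_ratio_pos ω i n).le]

theorem tendsto_coding (F : MoranFamily K 𝒜) (ω : ℕ → 𝒜 × Weights K) (i : ℕ → Fin K) :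
    Tendsto (fun n => F.comp ω i n 0) atTop (𝓝 (F.coding ω i)) := by
  have h : CauchySeq (fun n => F.comp ω i n 0) := by
    refine cauchySeq_of_le_geometric F.B 1 F.B_lt_one fun n => ?_
    simp only [comp, Function.comp_apply]
    rw [F.dist_comp, one_mul]
    have h1 : ∏ k ∈ Finset.range n, F.ratio (ω k).1 (i k) ≤ F.B ^ n := by
      calc _ ≤ ∏ _k ∈ Finset.range n, F.B :=
            Finset.prod_le_prod (fun k _ => (F.ratio_pos _ _).le) fun k _ => F.ratio_le _ _
        _ = _ := by simp
    have h2 : dist (0 : unitInterval) (F.map (ω n).1 (i n) 0) ≤ 1 := by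
      rw [Subtype.dist_eq]
      exact Real.dist_le_of_mem_Icc_01 (0 : unitInterval).2 (F.map (ω n).1 (i n) 0).2
    calc _ ≤ F.B ^ n * 1 := mul_le_mul h1 h2 dist_nonneg ((F.prod_ratio_pos ω i n).le.trans h1)
      _ = _ := mul_one _
  exact tendsto_nhds_limUnder (cauchySeq_tendsto_of_complete h)

theorem comp_congr (F : MoranFamily K 𝒜) (ω : ℕ → 𝒜 × Weights K) {i j : ℕ → Fin K} {n : ℕ}
    (h : ∀ k < n, i k = j k) : F.comp ω i n = F.comp ω j n := by
  induction n with
  | zero => rfl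
  | succ n ih =>
    simp only [comp]
    rw [ih fun k hk => h k (hk.trans n.lt_succ_self), h n n.lt_succ_self]

theorem eq_of_comp_eq (F : MoranFamily K 𝒜) (ω : ℕ → 𝒜 × Weights K) {i j : ℕ → Fin K} {n : ℕ}
    {x y : unitInterval} (h : F.comp ω i n x = F.comp ω j n y) : ∀ k < n, i k = j k := by
  induction n generalizing x y with
  | zero => simp
  | succ n ih =>
    have h1 : ∀ k < n, i k = j k := ih h
    simp only [comp, Function.comp_apply] at h
    rw [F.comp_congr ω h1] at h
    have h2 : dist (F.map (ω n).1 (i n) x) (F.map (ω n).1 (j n) y) = 0 := by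
      have h3 := F.dist_comp ω j n (F.map (ω n).1 (i n) x) (F.map (ω n).1 (j n) y)
      rw [h, dist_self] at h3
      exact (mul_eq_zero.1 h3.symm).resolve_left (F.prod_ratio_pos ω j n).ne'
    intro k hk
    rcases Nat.lt_succ_iff_lt_or_eq.1 hk with hk | rfl
    · exact h1 k hk
    · by_contra hne
      have := F.separated (ω k).1 (i k) (j k) hne x y
      rw [h2] at this
      exact absurd F.τ_pos (not_lt.2 this)

theorem coding_mem (F : MoranFamily K 𝒜) (ω : ℕ → 𝒜 × Weights K) (i : ℕ → Fin K) (n : ℕ) :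
    F.coding ω i ∈ F.moranInterval ω i n := by
  have hanti : ∀ m, F.moranInterval ω i (n + m) ⊆ F.moranInterval ω i n := by
    intro m
    induction m with
    | zero => exact subset_rfl
    | succ m ih =>
      refine Set.Subset.trans ?_ ih
      rintro _ ⟨x, rfl⟩
      exact ⟨F.map (ω (n + m)).1 (i (n + m)) x, rfl⟩
  have hcl : IsClosed (F.moranInterval ω i n) :=
    (isCompact_range (F.continuous_comp ω i n)).isClosed
  refine hcl.mem_of_tendsto (F.tendsto_coding ω i) ?_
  filter_upwards [eventually_ge_atTop n] with m hm
  obtain ⟨k, rfl⟩ := Nat.exists_eq_add_of_le hm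
  exact hanti k ⟨0, rfl⟩

theorem coding_mem_iff (F : MoranFamily K 𝒜) (ω : ℕ → 𝒜 × Weights K) (i j : ℕ → Fin K) (n : ℕ) :
    F.coding ω i ∈ F.moranInterval ω j n ↔ ∀ k < n, i k = j k := by
  constructor
  · rintro ⟨y, hy⟩
    obtain ⟨x, hx⟩ := F.coding_mem ω i n
    exact F.eq_of_comp_eq ω (hx.trans hy.symm)
  · intro h
    have := F.coding_mem ω i n
    rwa [moranInterval, F.comp_congr ω h] at this

theorem measurable_coding (F : MoranFamily K 𝒜) (ω : ℕ → 𝒜 × Weights K) :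
    Measurable (F.coding ω) := by
  refine measurable_of_tendsto_metrizable (f := fun n i => F.comp ω i n 0) (fun n => ?_)
    (tendsto_pi_nhds.2 fun i => F.tendsto_coding ω i)
  suffices h : ∀ n, Continuous fun q : (ℕ → Fin K) × unitInterval => F.comp ω q.1 n q.2 by
    exact ((h n).comp (continuous_id.prodMk continuous_const)).measurable
  intro n
  induction n with
  | zero => exact continuous_snd
  | succ n ih =>
    have hs : Continuous fun q : Fin K × unitInterval => F.map (ω n).1 q.1 q.2 := by
      refine continuous_prod_of_discrete_left.2 fun a => ?_
      refine LipschitzWith.continuous (K := Real.toNNReal (F.ratio (ω n).1 a))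
        (LipschitzWith.of_dist_le_mul fun x y => ?_)
      rw [F.dist_map, Real.coe_toNNReal _ (F.ratio_pos _ _).le]
    exact ih.comp (continuous_fst.prodMk
      (hs.comp (((continuous_apply n).comp continuous_fst).prodMk continuous_snd)))

/-- The rule that defines the random measure. -/
theorem randomMeasure_moranInterval (F : MoranFamily K 𝒜) (ω : ℕ → 𝒜 × Weights K)
    (i : ℕ → Fin K) (n : ℕ) :
    F.randomMeasure ω (F.moranInterval ω i n) =
      ∏ k ∈ Finset.range n, ENNReal.ofReal ((ω k).2 (i k)) := by
  have hcl : IsClosed (F.moranInterval ω i n) :=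
    (isCompact_range (F.continuous_comp ω i n)).isClosed
  rw [randomMeasure, Measure.map_apply (F.measurable_coding ω) hcl.measurableSet]
  have hpre : F.coding ω ⁻¹' F.moranInterval ω i n =
      Set.pi (Finset.range n : Set ℕ) fun k => {i k} := by
    ext j
    simp [F.coding_mem_iff]
  rw [hpre, Measure.infinitePi_pi _ fun k _ => measurableSet_singleton _]
  refine Finset.prod_congr rfl fun k _ => ?_
  rw [PMF.toMeasure_apply_singleton _ _ (measurableSet_singleton _)]
  rfl

instance (F : MoranFamily K 𝒜) (ω : ℕ → 𝒜 × Weights K) :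
    IsProbabilityMeasure (F.randomMeasure ω) :=
  Measure.isProbabilityMeasure_map (F.measurable_coding ω).aemeasurable

end MoranFamily

end

/-!
Because of the separation, a ball of radius `R` around a point of the support has at most the mass
of a Moran interval around that point, and at least the mass of another one, both of length
comparable with `R`. So only Moran intervals along an address have to be compared. Between the
steps `n` and `n + m` of the construction the quotient `length ^ d / mass` grows at most by the
factor `exp (φ (ω n) + ⋯ + φ (ω (n + m - 1)))`, with the potential
`φ (u, p) = max_i (d log a(i,u) - log p(i))`, and some address attains this bound at every step.

The almost sure dimension is the zero of the pressure, the expectation of the potential as a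
function of `d`, which is strictly decreasing because all ratios are at most `B < 1`.
* If the pressure at `d` is positive, the sums of the potential tend to infinity by the strong law
  of large numbers, and the worst address violates the defining inequality for every smaller
  exponent (`MoranFamily.le_upperPhiDim`).
* If it is negative, admissibility provides an exponential moment with expectation less than one,
  so the sums over windows of length `m ≥ c log n` starting at step `n` are almost surely bounded
  above (`exists_ae_window_sum_le`). A large dimension function only sees such windows
  (`MoranFamily.eventually_rpow_le`), and the dimension is at most `d`
  (`MoranFamily.upperPhiDim_le`).

Neither bound depends on `Φ`. For the infimum, Jensen's inequality shows that the
normalized geometric means of the weights have a pressure no larger than that of `ℛ`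
(`MoranFamily.exists_pressure_dirac_le`). So only single weight vectors matter; the zero of the
pressure is continuous in them, and where it is bounded the weights stay away from `0`, so that it
attains its minimum by compactness (`MoranFamily.exists_isMin_pressure_zero`).
-/

open ProbabilityTheory

/-! ### Admissible distributions of the weights -/

theorem measurable_weight_apply {K : ℕ} (i : Fin K) : Measurable fun p : Weights K => p i :=
  (measurable_pi_apply i).comp measurable_subtype_coe

theorem continuous_weight_apply {K : ℕ} (i : Fin K) : Continuous fun p : Weights K => p i :=
  (continuous_apply i).comp continuous_subtype_val

theorem weight_nonneg {K : ℕ} (p : Weights K) (i : Fin K) : 0 ≤ p i :=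
  p.2.1 i

theorem sum_weight {K : ℕ} (p : Weights K) : ∑ i, p i = 1 :=
  p.2.2

theorem weight_le_one {K : ℕ} (p : Weights K) (i : Fin K) : p i ≤ 1 :=
  (Finset.single_le_sum (fun j _ => weight_nonneg p j) (Finset.mem_univ i)).trans (sum_weight p).le

theorem IsValidWeight.pos {K : ℕ} {p : Weights K} (hp : IsValidWeight p) (i : Fin K) : 0 < p i :=
  (weight_nonneg p i).lt_of_ne' (hp i)

/-- Under an admissible distribution the weights are almost surely positive, so that the moment
condition can be stated with real powers. -/
theorem IsAdmissible.exists_integrable_rpow {K : ℕ} {ℛ : Measure (Weights K)}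
    (h : IsAdmissible ℛ) :
    (∀ᵐ p ∂ℛ, ∀ i, 0 < p i) ∧
      ∃ t : ℝ, 0 < t ∧ ∀ i, Integrable (fun p : Weights K => p i ^ (-t)) ℛ := by
  obtain ⟨hprob, t, ht, hfin⟩ := h
  have hmeas : ∀ i, Measurable fun p : Weights K => ENNReal.ofReal (p i) ^ (-t) := fun i =>
    (measurable_weight_apply i).ennreal_ofReal.pow_const _
  refine ⟨ae_all_iff.2 fun i => ?_, t, ht, fun i => ?_⟩
  · filter_upwards [ae_lt_top (hmeas i) (hfin i).ne] with p hp
    refine (weight_nonneg p i).lt_of_ne' fun h0 => ?_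
    rw [h0, ENNReal.ofReal_zero, ENNReal.zero_rpow_of_neg (by linarith)] at hp
    exact lt_irrefl _ hp
  · have h1 := integrable_toReal_of_lintegral_ne_top (hmeas i).aemeasurable (hfin i).ne
    refine h1.congr (Eventually.of_forall fun p => ?_)
    simp only [← ENNReal.toReal_rpow, ENNReal.toReal_ofReal (weight_nonneg p i)]

theorem IsValidWeight.isAdmissible_dirac {K : ℕ} {p : Weights K} (hp : IsValidWeight p) :
    IsAdmissible (Measure.dirac p) := by
  refine ⟨inferInstance, 1, one_pos, fun i => ?_⟩
  rw [lintegral_dirac' _ ((measurable_weight_apply i).ennreal_ofReal.pow_const _)]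
  refine (ENNReal.rpow_ne_top_of_ne_zero ?_ ENNReal.ofReal_ne_top).lt_top
  simpa using hp.pos i

namespace MoranFamily

variable {K : ℕ} {𝒜 : Type*} [MeasurableSpace 𝒜]

/-! ### The potential -/

theorem fin_nonempty (F : MoranFamily K 𝒜) : Nonempty (Fin K) :=
  ⟨⟨0, by have := F.two_le; omega⟩⟩

theorem ratio_lt_one (F : MoranFamily K 𝒜) (u : 𝒜) (i : Fin K) : F.ratio u i < 1 :=
  (F.ratio_le u i).trans_lt F.B_lt_one

theorem A_le_B (F : MoranFamily K 𝒜) : F.A ≤ F.B := by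
  have h1 : (2 : ℝ) ≤ K := by exact_mod_cast F.two_le
  nlinarith [F.A_pos, F.mul_A_le_B]

theorem B_pos (F : MoranFamily K 𝒜) : 0 < F.B := F.A_pos.trans_le F.A_le_B

theorem A_lt_one (F : MoranFamily K 𝒜) : F.A < 1 := F.A_le_B.trans_lt F.B_lt_one

theorem log_A_neg (F : MoranFamily K 𝒜) : Real.log F.A < 0 := Real.log_neg F.A_pos F.A_lt_one

theorem log_B_neg (F : MoranFamily K 𝒜) : Real.log F.B < 0 := Real.log_neg F.B_pos F.B_lt_one

theorem log_A_le_log_ratio (F : MoranFamily K 𝒜) (u : 𝒜) (i : Fin K) :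
    Real.log F.A ≤ Real.log (F.ratio u i) :=
  Real.log_le_log F.A_pos (F.A_le_ratio u i)

theorem log_ratio_le_log_B (F : MoranFamily K 𝒜) (u : 𝒜) (i : Fin K) :
    Real.log (F.ratio u i) ≤ Real.log F.B :=
  Real.log_le_log (F.ratio_pos u i) (F.ratio_le u i)

/-- The logarithm of the largest `a(i,u) ^ d / p(i)`, that is, of the largest factor by which the
quotient `length ^ d / mass` of Moran intervals can grow in a single step of the construction.
A vanishing weight contributes the junk value `log 0 = 0`; under an admissible distribution all
weights are almost surely positive. -/
noncomputable def potential (F : MoranFamily K 𝒜) (d : ℝ) (z : 𝒜 × Weights K) : ℝ :=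
  ⨆ i, (d * Real.log (F.ratio z.1 i) - Real.log (z.2 i))

theorem le_potential (F : MoranFamily K 𝒜) (d : ℝ) (z : 𝒜 × Weights K) (i : Fin K) :
    d * Real.log (F.ratio z.1 i) - Real.log (z.2 i) ≤ F.potential d z :=
  le_ciSup (f := fun i => d * Real.log (F.ratio z.1 i) - Real.log (z.2 i))
    (Set.finite_range _).bddAbove i

theorem potential_le (F : MoranFamily K 𝒜) {d : ℝ} {z : 𝒜 × Weights K} {c : ℝ}
    (h : ∀ i, d * Real.log (F.ratio z.1 i) - Real.log (z.2 i) ≤ c) : F.potential d z ≤ c :=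
  have := F.fin_nonempty
  ciSup_le h

theorem exists_eq_potential (F : MoranFamily K 𝒜) (d : ℝ) (z : 𝒜 × Weights K) :
    ∃ i, d * Real.log (F.ratio z.1 i) - Real.log (z.2 i) = F.potential d z :=
  have := F.fin_nonempty
  exists_eq_ciSup_of_finite

theorem measurable_potential (F : MoranFamily K 𝒜) (d : ℝ) : Measurable (F.potential d) :=
  Measurable.iSup fun i =>
    (((F.measurable_ratio i).comp measurable_fst).log.const_mul d).sub
      ((measurable_weight_apply i).comp measurable_snd).log

theorem potential_le_add (F : MoranFamily K 𝒜) {d e : ℝ} (h : d ≤ e) (z : 𝒜 × Weights K) :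
    F.potential e z ≤ F.potential d z + (e - d) * Real.log F.B := by
  refine F.potential_le fun i => ?_
  have h1 := F.le_potential d z i
  have h2 := mul_le_mul_of_nonneg_left (F.log_ratio_le_log_B z.1 i) (sub_nonneg.2 h)
  linarith

theorem add_le_potential (F : MoranFamily K 𝒜) {d e : ℝ} (h : d ≤ e) (z : 𝒜 × Weights K) :
    F.potential d z + (e - d) * Real.log F.A ≤ F.potential e z := by
  rw [← le_sub_iff_add_le]
  refine F.potential_le fun i => ?_
  have h1 := F.le_potential e z i
  have h2 := mul_le_mul_of_nonneg_left (F.log_A_le_log_ratio z.1 i) (sub_nonneg.2 h)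
  linarith

theorem neg_log_weight_le (F : MoranFamily K 𝒜) {d : ℝ} (hd : 0 ≤ d) (z : 𝒜 × Weights K)
    (i : Fin K) : -Real.log (z.2 i) ≤ F.potential d z - d * Real.log F.A := by
  have h1 := F.le_potential d z i
  have h2 := mul_le_mul_of_nonneg_left (F.log_A_le_log_ratio z.1 i) hd
  linarith

theorem le_potential_of_nonneg (F : MoranFamily K 𝒜) {d : ℝ} (hd : 0 ≤ d) (z : 𝒜 × Weights K) :
    d * Real.log F.A ≤ F.potential d z := by
  obtain ⟨i⟩ := F.fin_nonempty
  have h1 := F.neg_log_weight_le hd z i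
  have h2 := Real.log_nonpos (weight_nonneg z.2 i) (weight_le_one z.2 i)
  linarith

/-- Some weight is at most `1 / K`. -/
theorem log_card_le_potential_zero (F : MoranFamily K 𝒜) {z : 𝒜 × Weights K}
    (hz : ∀ i, 0 < z.2 i) : Real.log K ≤ F.potential 0 z := by
  have hK : (0 : ℝ) < K := by exact_mod_cast (by have := F.two_le; omega : 0 < K)
  have : ∃ i, z.2 i ≤ (K : ℝ)⁻¹ := by
    by_contra! h
    have := F.fin_nonempty
    have h1 : ∑ _i : Fin K, (K : ℝ)⁻¹ < ∑ i, z.2 i :=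
      Finset.sum_lt_sum_of_nonempty Finset.univ_nonempty fun i _ => h i
    simp [hK.ne'] at h1
  obtain ⟨i, hi⟩ := this
  have h1 := F.le_potential 0 z i
  have h2 := Real.log_le_log (hz i) hi
  rw [Real.log_inv] at h2
  linarith

/-! ### Exponential moments and the pressure -/

variable {𝒬 : Measure 𝒜} [IsProbabilityMeasure 𝒬] {ℛ : Measure (Weights K)}

/-- The potential has exponential moments near `0`: it is bounded below, and above by the largest
`-log p(i)`, whose exponential moments are the negative moments of the weights. -/
theorem zero_mem_interior_integrableExpSet (F : MoranFamily K 𝒜) (hℛ : IsAdmissible ℛ) {d : ℝ}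
    (hd : 0 ≤ d) : (0 : ℝ) ∈ interior (integrableExpSet (F.potential d) (𝒬.prod ℛ)) := by
  have := hℛ.1
  obtain ⟨hpos, t, ht, hint⟩ := hℛ.exists_integrable_rpow
  have hpos' : ∀ᵐ z ∂𝒬.prod ℛ, ∀ i, 0 < z.2 i :=
    Measure.quasiMeasurePreserving_snd.ae hpos
  rw [mem_interior_iff_mem_nhds]
  filter_upwards [Iic_mem_nhds ht] with s hs
  have hbd : Integrable (fun z : 𝒜 × Weights K =>
      Real.exp (s * (d * Real.log F.A)) + ∑ i, z.2 i ^ (-t)) (𝒬.prod ℛ) :=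
    (integrable_const _).add (integrable_finsetSum _ fun i _ => (hint i).comp_snd 𝒬)
  refine hbd.mono' ((F.measurable_potential d).const_mul s).exp.aestronglyMeasurable ?_
  filter_upwards [hpos'] with z hz
  rw [Real.norm_of_nonneg (Real.exp_pos _).le]
  have hsum : ∀ i, 0 ≤ z.2 i ^ (-t) := fun i => Real.rpow_nonneg (weight_nonneg _ _) _
  rcases le_total s 0 with hs0 | hs0
  · have h1 := mul_le_mul_of_nonpos_left (F.le_potential_of_nonneg hd z) hs0
    have h2 := Finset.sum_nonneg fun i (_ : i ∈ Finset.univ) => hsum i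
    linarith [Real.exp_le_exp.2 h1]
  · obtain ⟨i, hi⟩ := F.exists_eq_potential d z
    have h1 : d * Real.log (F.ratio z.1 i) ≤ 0 := mul_nonpos_of_nonneg_of_nonpos hd
      ((F.log_ratio_le_log_B z.1 i).trans F.log_B_neg.le)
    have h2 := Real.log_nonpos (weight_nonneg z.2 i) (weight_le_one z.2 i)
    have h3 : s * F.potential d z ≤ Real.log (z.2 i) * (-t) := by
      rw [← hi]
      have h4 : s * (-Real.log (z.2 i)) ≤ t * (-Real.log (z.2 i)) :=
        mul_le_mul_of_nonneg_right hs (by linarith)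
      have h5 := mul_nonpos_of_nonneg_of_nonpos hs0 h1
      linarith
    have h4 : Real.exp (s * F.potential d z) ≤ z.2 i ^ (-t) := by
      rw [Real.rpow_def_of_pos (hz i)]
      exact Real.exp_le_exp.2 h3
    have h5 := Finset.single_le_sum (fun j _ => hsum j) (Finset.mem_univ i)
    linarith [Real.exp_pos (s * (d * Real.log F.A))]

theorem integrable_potential (F : MoranFamily K 𝒜) (hℛ : IsAdmissible ℛ) {d : ℝ} (hd : 0 ≤ d) :
    Integrable (F.potential d) (𝒬.prod ℛ) :=
  have := hℛ.1
  (memLp_of_mem_interior_integrableExpSet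
    (F.zero_mem_interior_integrableExpSet hℛ hd) 1).integrable (by simp)

/-- If the potential has negative expectation, then its moment generating function falls below one
to the right of `0`, because its derivative at `0` is the expectation. -/
theorem exists_mgf_potential_lt_one (F : MoranFamily K 𝒜) (hℛ : IsAdmissible ℛ) {d : ℝ}
    (hd : 0 ≤ d) (hneg : ∫ z, F.potential d z ∂(𝒬.prod ℛ) < 0) :
    ∃ s : ℝ, 0 < s ∧ Integrable (fun z => Real.exp (s * F.potential d z)) (𝒬.prod ℛ) ∧
      mgf (F.potential d) (𝒬.prod ℛ) s < 1 := by
  have := hℛ.1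
  have h0 := F.zero_mem_interior_integrableExpSet (𝒬 := 𝒬) hℛ hd
  have hder := hasDerivAt_mgf h0
  simp only [zero_mul, Real.exp_zero, mul_one] at hder
  have hlt := (hasDerivWithinAt_iff_tendsto_slope' (s := Set.Ioi 0) (by simp)).1
    hder.hasDerivWithinAt
  have h1 := hlt.eventually (gt_mem_nhds hneg)
  have h2 : ∀ᶠ s in 𝓝[>] (0 : ℝ), s ∈ integrableExpSet (F.potential d) (𝒬.prod ℛ) :=
    mem_nhdsWithin_of_mem_nhds (mem_interior_iff_mem_nhds.1 h0)
  obtain ⟨s, hs1, hs2, hs3⟩ := (h1.and (h2.and self_mem_nhdsWithin)).exists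
  refine ⟨s, hs3, hs2, ?_⟩
  have hs0 : 0 < s := hs3
  rw [slope_def_field, mgf_zero, sub_zero, div_lt_iff₀ hs0] at hs1
  linarith

variable (𝒬 ℛ) in
/-- The mean growth rate of `length ^ d / mass` along the address which makes it grow fastest. Its
zero is the almost sure upper dimension. -/
noncomputable def pressure (F : MoranFamily K 𝒜) (d : ℝ) : ℝ :=
  ∫ z, F.potential d z ∂(𝒬.prod ℛ)

theorem pressure_le_add (F : MoranFamily K 𝒜) (hℛ : IsAdmissible ℛ) {d e : ℝ} (hd : 0 ≤ d)
    (h : d ≤ e) : F.pressure 𝒬 ℛ e ≤ F.pressure 𝒬 ℛ d + (e - d) * Real.log F.B := by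
  have := hℛ.1
  have h1 : F.pressure 𝒬 ℛ e ≤
      ∫ z, (F.potential d z + (e - d) * Real.log F.B) ∂(𝒬.prod ℛ) :=
    integral_mono (F.integrable_potential hℛ (hd.trans h))
      ((F.integrable_potential hℛ hd).add (integrable_const _)) fun z => F.potential_le_add h z
  rwa [integral_add (F.integrable_potential hℛ hd) (integrable_const _), integral_const,
    probReal_univ, one_smul] at h1

theorem add_le_pressure (F : MoranFamily K 𝒜) (hℛ : IsAdmissible ℛ) {d e : ℝ} (hd : 0 ≤ d)
    (h : d ≤ e) : F.pressure 𝒬 ℛ d + (e - d) * Real.log F.A ≤ F.pressure 𝒬 ℛ e := by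
  have := hℛ.1
  have h1 : ∫ z, (F.potential d z + (e - d) * Real.log F.A) ∂(𝒬.prod ℛ) ≤ F.pressure 𝒬 ℛ e :=
    integral_mono ((F.integrable_potential hℛ hd).add (integrable_const _))
      (F.integrable_potential hℛ (hd.trans h)) fun z => F.add_le_potential h z
  rwa [integral_add (F.integrable_potential hℛ hd) (integrable_const _), integral_const,
    probReal_univ, one_smul] at h1

theorem pressure_zero_pos (F : MoranFamily K 𝒜) (hℛ : IsAdmissible ℛ) :
    0 < F.pressure 𝒬 ℛ 0 := by
  have := hℛ.1
  have hpos : ∀ᵐ z ∂𝒬.prod ℛ, ∀ i, 0 < z.2 i :=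
    Measure.quasiMeasurePreserving_snd.ae hℛ.exists_integrable_rpow.1
  have h1 : ∫ _z, Real.log K ∂(𝒬.prod ℛ) ≤ F.pressure 𝒬 ℛ 0 :=
    integral_mono_ae (integrable_const _) (F.integrable_potential hℛ le_rfl)
      (hpos.mono fun z hz => F.log_card_le_potential_zero hz)
  rw [integral_const, probReal_univ, one_smul] at h1
  have h2 : (1 : ℝ) < K := by exact_mod_cast (by have := F.two_le; omega : 1 < K)
  exact (Real.log_pos h2).trans_le h1

theorem exists_pressure_eq_zero (F : MoranFamily K 𝒜) (𝒬 : Measure 𝒜) [IsProbabilityMeasure 𝒬]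
    (hℛ : IsAdmissible ℛ) : ∃ α : ℝ, 0 < α ∧ F.pressure 𝒬 ℛ α = 0 := by
  have h0 := F.pressure_zero_pos (𝒬 := 𝒬) hℛ
  have hB := F.log_B_neg
  have hb : 0 ≤ F.pressure 𝒬 ℛ 0 / -Real.log F.B := div_nonneg h0.le (by linarith)
  have h1 := F.pressure_le_add (𝒬 := 𝒬) hℛ le_rfl hb
  have h2 : F.pressure 𝒬 ℛ 0 + (F.pressure 𝒬 ℛ 0 / -Real.log F.B - 0) * Real.log F.B = 0 := by
    have : Real.log F.B ≠ 0 := hB.ne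
    field_simp
    ring
  rw [h2] at h1
  have hcont : ContinuousOn (F.pressure 𝒬 ℛ) (Set.Icc 0 (F.pressure 𝒬 ℛ 0 / -Real.log F.B)) := by
    refine (LipschitzOnWith.of_le_add_mul (K := Real.toNNReal (-Real.log F.A))
      fun x hx y hy => ?_).continuousOn
    rw [Real.coe_toNNReal _ (by linarith [F.log_A_neg]), Real.dist_eq]
    rcases le_total x y with hxy | hxy
    · have := F.add_le_pressure (𝒬 := 𝒬) hℛ hx.1 hxy
      rw [abs_of_nonpos (by linarith)]
      linarith
    · have := F.pressure_le_add (𝒬 := 𝒬) hℛ hy.1 hxy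
      have h3 := mul_nonneg (sub_nonneg.2 hxy) (neg_pos.2 hB).le
      have h4 := mul_nonneg (neg_pos.2 F.log_A_neg).le (abs_nonneg (x - y))
      linarith
  obtain ⟨α, hα, hα0⟩ := intermediate_value_Icc' hb hcont ⟨h1, h0.le⟩
  refine ⟨α, hα.1.lt_of_ne fun h => ?_, hα0⟩
  rw [← h] at hα0
  exact h0.ne' hα0

end MoranFamily

namespace MoranFamily

variable {K : ℕ} {𝒜 : Type*} [MeasurableSpace 𝒜]

/-! ### Balls and Moran intervals -/

/-- The scaling ratio of `S_{i₁}(ω₁) ∘ ⋯ ∘ S_{iₙ}(ωₙ)`, that is, the length of the step `n` Moran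
interval with address `i`. -/
noncomputable def scale (F : MoranFamily K 𝒜) (ω : ℕ → 𝒜 × Weights K) (i : ℕ → Fin K) (n : ℕ) :
    ℝ :=
  ∏ k ∈ Finset.range n, F.ratio (ω k).1 (i k)

/-- The product of the weights along the first `n` letters of the address `i`, that is, the mass
of the step `n` Moran interval with address `i`. -/
noncomputable def mass (ω : ℕ → 𝒜 × Weights K) (i : ℕ → Fin K) (n : ℕ) : ℝ :=
  ∏ k ∈ Finset.range n, (ω k).2 (i k)

variable (F : MoranFamily K 𝒜) (ω : ℕ → 𝒜 × Weights K) (i : ℕ → Fin K)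

@[simp] theorem scale_zero : F.scale ω i 0 = 1 := by simp [scale]

theorem scale_succ (n : ℕ) :
    F.scale ω i (n + 1) = F.scale ω i n * F.ratio (ω n).1 (i n) :=
  Finset.prod_range_succ _ _

theorem scale_pos (n : ℕ) : 0 < F.scale ω i n := F.prod_ratio_pos ω i n

theorem antitone_scale : Antitone (F.scale ω i) :=
  antitone_nat_of_succ_le fun n => by
    rw [scale_succ]
    exact mul_le_of_le_one_right (F.scale_pos ω i n).le (F.ratio_lt_one _ _).le

theorem scale_le_pow (n : ℕ) : F.scale ω i n ≤ F.B ^ n := by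
  calc F.scale ω i n ≤ ∏ _k ∈ Finset.range n, F.B :=
        Finset.prod_le_prod (fun k _ => (F.ratio_pos _ _).le) fun k _ => F.ratio_le _ _
    _ = F.B ^ n := by simp

theorem tendsto_scale : Tendsto (F.scale ω i) atTop (𝓝 0) :=
  squeeze_zero (fun n => (F.scale_pos ω i n).le) (F.scale_le_pow ω i)
    (tendsto_pow_atTop_nhds_zero_of_lt_one F.B_pos.le F.B_lt_one)

theorem mul_pow_le_scale_add (n m : ℕ) :
    F.scale ω i n * F.A ^ m ≤ F.scale ω i (n + m) := by
  induction m with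
  | zero => simp
  | succ m ih =>
    rw [← add_assoc, scale_succ, pow_succ, ← mul_assoc]
    exact mul_le_mul ih (F.A_le_ratio _ _) F.A_pos.le (F.scale_pos ω i _).le

/-- The last step before the Moran intervals along an address become shorter than `r`. -/
theorem exists_scale_lt_le {r : ℝ} (hr : 0 < r) (hr1 : r ≤ 1) :
    ∃ n, F.scale ω i (n + 1) < r ∧ r ≤ F.scale ω i n := by
  classical
  have hex : ∃ n, F.scale ω i n < r := ((F.tendsto_scale ω i).eventually (gt_mem_nhds hr)).exists
  have hne : Nat.find hex ≠ 0 := fun h => by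
    have h1 := Nat.find_spec hex
    rw [h, scale_zero] at h1
    exact absurd h1 (not_lt.2 hr1)
  obtain ⟨n, hn⟩ := Nat.exists_eq_succ_of_ne_zero hne
  exact ⟨n, by simpa [hn] using Nat.find_spec hex,
    not_lt.1 (Nat.find_min hex (by rw [hn]; exact n.lt_succ_self))⟩

theorem tau_lt_one : F.τ < 1 := by
  have h1 : (2 : ℝ) ≤ K := by exact_mod_cast F.two_le
  refine F.τ_le.trans_lt ((div_lt_one (by linarith)).2 ?_)
  linarith [F.B_pos]

theorem mass_pos {𝒜 : Type*} {ω : ℕ → 𝒜 × Weights K} (i : ℕ → Fin K)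
    (hω : ∀ k j, 0 < (ω k).2 j) (n : ℕ) : 0 < mass ω i n :=
  Finset.prod_pos fun k _ => hω k _

theorem real_moranInterval (n : ℕ) :
    (F.randomMeasure ω).real (F.moranInterval ω i n) = mass ω i n := by
  rw [measureReal_def, randomMeasure_moranInterval, ENNReal.toReal_prod, mass]
  exact Finset.prod_congr rfl fun k _ => ENNReal.toReal_ofReal (weight_nonneg _ _)

/-- Points whose addresses differ at one of the first `n + 1` places are far apart. -/
theorem eq_of_dist_coding_lt {j : ℕ → Fin K} {n : ℕ}
    (h : dist (F.coding ω j) (F.coding ω i) < F.τ * F.scale ω i n) :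
    ∀ k < n + 1, j k = i k := by
  intro k
  induction k using Nat.strong_induction_on with
  | _ k ih =>
    intro hk
    by_contra hne
    have hagree : ∀ l < k, j l = i l := fun l hl => ih l hl (hl.trans hk)
    obtain ⟨x, hx⟩ := F.coding_mem ω j (k + 1)
    obtain ⟨y, hy⟩ := F.coding_mem ω i (k + 1)
    have hd : F.τ * F.scale ω i k ≤ dist (F.coding ω j) (F.coding ω i) := by
      rw [← hx, ← hy]
      simp only [comp, Function.comp_apply]
      rw [F.comp_congr ω hagree, F.dist_comp, mul_comm]
      exact mul_le_mul_of_nonneg_left (F.separated _ _ _ hne x y) (F.scale_pos ω i k).le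
    have h2 := F.antitone_scale ω i (Nat.lt_succ_iff.1 hk)
    have h3 := mul_le_mul_of_nonneg_left h2 F.τ_pos.le
    linarith

/-- A ball which is small compared with the gaps between the step `n + 1` Moran intervals carries
at most the mass of one of them. -/
theorem real_ball_le_mass {n : ℕ} {r : ℝ} (hr : r ≤ F.τ * F.scale ω i n) :
    (F.randomMeasure ω).real (Metric.ball (F.coding ω i) r) ≤ mass ω i (n + 1) := by
  rw [← F.real_moranInterval ω i (n + 1)]
  refine ENNReal.toReal_mono (measure_ne_top _ _) ?_
  have hcl : IsClosed (F.moranInterval ω i (n + 1)) :=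
    (isCompact_range (F.continuous_comp ω i (n + 1))).isClosed
  rw [randomMeasure, Measure.map_apply (F.measurable_coding ω) hcl.measurableSet,
    Measure.map_apply (F.measurable_coding ω) Metric.isOpen_ball.measurableSet]
  refine measure_mono fun j hj => ?_
  exact (F.coding_mem_iff ω j i (n + 1)).2
    (F.eq_of_dist_coding_lt ω i ((Metric.mem_ball.1 hj).trans_le hr))

theorem dist_le_scale {n : ℕ} {x y : unitInterval} (hx : x ∈ F.moranInterval ω i n)
    (hy : y ∈ F.moranInterval ω i n) : dist x y ≤ F.scale ω i n := by
  obtain ⟨x, rfl⟩ := hx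
  obtain ⟨y, rfl⟩ := hy
  rw [F.dist_comp]
  refine mul_le_of_le_one_right (F.scale_pos ω i n).le ?_
  rw [Subtype.dist_eq]
  exact Real.dist_le_of_mem_Icc_01 x.2 y.2

theorem moranInterval_subset_ball {n : ℕ} {r : ℝ} (hr : F.scale ω i n < r) :
    F.moranInterval ω i n ⊆ Metric.ball (F.coding ω i) r := fun _ hx =>
  (F.dist_le_scale ω i hx (F.coding_mem ω i n)).trans_lt hr

theorem mass_le_real_ball {n : ℕ} {r : ℝ} (hr : F.scale ω i n < r) :
    mass ω i n ≤ (F.randomMeasure ω).real (Metric.ball (F.coding ω i) r) := by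
  rw [← F.real_moranInterval ω i n]
  exact measureReal_mono (F.moranInterval_subset_ball ω i hr)

theorem continuous_coding : Continuous (F.coding ω) := by
  refine continuous_iff_continuousAt.2 fun i => Metric.tendsto_nhds.2 fun ε hε => ?_
  obtain ⟨n, hn⟩ := ((F.tendsto_scale ω i).eventually (gt_mem_nhds hε)).exists
  have h1 : ∀ᶠ j in 𝓝 i, ∀ k ∈ Finset.range n, j k = i k :=
    (Finset.eventually_all _).2 fun k _ =>
      ((isOpen_discrete ({i k} : Set (Fin K))).preimage
        (continuous_apply (A := fun _ : ℕ => Fin K) k)).mem_nhds (Set.mem_singleton (i k))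
  filter_upwards [h1] with j hj
  have hj' := (F.coding_mem_iff ω j i n).2 fun k hk => hj k (Finset.mem_range.2 hk)
  exact (F.dist_le_scale ω i hj' (F.coding_mem ω i n)).trans_lt hn

theorem support_subset_range_coding :
    (F.randomMeasure ω).support ⊆ Set.range (F.coding ω) := by
  have hcl : IsClosed (Set.range (F.coding ω)) := (isCompact_range (F.continuous_coding ω)).isClosed
  refine Measure.support_subset_of_isClosed hcl ?_
  rw [randomMeasure, mem_ae_map_iff (F.measurable_coding ω).aemeasurable hcl.measurableSet]
  simp

variable {ω} in
theorem coding_mem_support (hω : ∀ k j, 0 < (ω k).2 j) :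
    F.coding ω i ∈ (F.randomMeasure ω).support := by
  refine (Measure.mem_support_iff_forall _).2 fun U hU => ?_
  obtain ⟨r, hr, hrU⟩ := Metric.mem_nhds_iff.1 hU
  obtain ⟨n, hn⟩ := ((F.tendsto_scale ω i).eventually (gt_mem_nhds hr)).exists
  refine lt_of_lt_of_le ?_ (measure_mono hrU)
  refine pos_iff_ne_zero.2 fun h0 => ?_
  have h1 := F.mass_le_real_ball ω i hn
  rw [measureReal_def, h0, ENNReal.toReal_zero] at h1
  exact absurd (mass_pos i hω n) (not_lt.2 h1)

/-! ### Growth of the potential and the upper dimension of a realization -/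

variable {ω} in
/-- Along every address the logarithmic loss of mass is controlled by the potential. -/
theorem mass_le_exp_mul (hω : ∀ k j, 0 < (ω k).2 j) (d : ℝ) (n m : ℕ) :
    mass ω i n ≤ mass ω i (n + m) * (F.scale ω i n / F.scale ω i (n + m)) ^ d *
      Real.exp (∑ k ∈ Finset.range m, F.potential d (ω (n + k))) := by
  induction m with
  | zero => simp [(F.scale_pos ω i n).ne']
  | succ m ih =>
    refine ih.trans ?_
    have ha := F.ratio_pos (ω (n + m)).1 (i (n + m))
    have hp := hω (n + m) (i (n + m))
    have h1 : 1 ≤ (ω (n + m)).2 (i (n + m)) * (F.ratio (ω (n + m)).1 (i (n + m)))⁻¹ ^ d *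
        Real.exp (F.potential d (ω (n + m))) := by
      have h2 := F.le_potential d (ω (n + m)) (i (n + m))
      rw [Real.inv_rpow ha.le, Real.rpow_def_of_pos ha, ← Real.exp_neg]
      nth_rewrite 1 [← Real.exp_log hp]
      rw [← Real.exp_add, ← Real.exp_add]
      exact Real.one_le_exp (by linarith)
    have h3 : F.scale ω i n / F.scale ω i (n + (m + 1)) =
        F.scale ω i n / F.scale ω i (n + m) * (F.ratio (ω (n + m)).1 (i (n + m)))⁻¹ := by
      rw [← add_assoc, scale_succ, div_mul_eq_div_div, div_eq_mul_inv _ (F.ratio _ _)]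
    have h4 : mass ω i (n + (m + 1)) = mass ω i (n + m) * (ω (n + m)).2 (i (n + m)) :=
      Finset.prod_range_succ _ _
    rw [h3, h4, Finset.sum_range_succ, Real.exp_add, Real.mul_rpow
      (div_pos (F.scale_pos ω i n) (F.scale_pos ω i _)).le (inv_pos.2 ha).le]
    have h5 : 0 ≤ mass ω i (n + m) * (F.scale ω i n / F.scale ω i (n + m)) ^ d *
        Real.exp (∑ k ∈ Finset.range m, F.potential d (ω (n + k))) :=
      mul_nonneg (mul_nonneg (mass_pos i hω _).le (Real.rpow_nonneg
        (div_pos (F.scale_pos ω i n) (F.scale_pos ω i _)).le _)) (Real.exp_pos _).le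
    calc _ ≤ _ := le_mul_of_one_le_right h5 h1
      _ = _ := by ring

/-- The windows between the radii `R` and `R ^ (1 + Φ R)` are eventually longer than any fixed
multiple of the logarithm of the number of construction steps before them. -/
theorem eventually_rpow_le {Φ : ℝ → ℝ} (hΦ : IsLargeDimensionFunction Φ) (c : ℝ) (hc : 0 ≤ c) :
    ∀ᶠ R in 𝓝[>] (0 : ℝ), ∀ n : ℕ, R ≤ F.B ^ n →
      R ^ Φ R ≤ F.A ^ (⌈c * Real.log (n + 2)⌉₊ + 1) := by
  obtain ⟨H, hH, hΦH⟩ := hΦ.large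
  have hA := F.log_A_neg
  have hB := F.log_B_neg
  have hlog : Tendsto (fun R => |Real.log R|) (𝓝[>] (0 : ℝ)) atTop :=
    tendsto_abs_atBot_atTop.comp Real.tendsto_log_nhdsGT_zero
  -- `n` is at most `|log R| / |log B|`, so that `log (n + 2)` is at most `2 log |log R|`
  have hquad : ∀ᶠ L in atTop, L / -Real.log F.B + 2 ≤ L ^ 2 := by
    filter_upwards [eventually_ge_atTop ((-Real.log F.B)⁻¹ + 2), eventually_ge_atTop 1]
      with L hL hL1
    have h1 : 0 < (-Real.log F.B)⁻¹ := inv_pos.2 (by linarith)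
    rw [div_eq_mul_inv]
    nlinarith
  have hloglog := (Real.tendsto_log_atTop.comp hlog).eventually_ge_atTop 2
  filter_upwards [hΦH, hH.eventually_ge_atTop ((2 * c + 1) * -Real.log F.A), hlog.eventually hquad,
    hloglog, hlog.eventually_gt_atTop 0, Ioo_mem_nhdsGT (one_pos)]
    with R hR1 hR2 hR3 hR4 hR5 hR6 n hn
  simp only [Function.comp_apply] at hR4
  have hlogR : Real.log R < 0 := Real.log_neg hR6.1 hR6.2
  have habs : |Real.log R| = -Real.log R := abs_of_neg hlogR
  have hn1 : (n : ℝ) ≤ |Real.log R| / -Real.log F.B := by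
    rw [le_div_iff₀ (by linarith), habs]
    have := Real.log_le_log hR6.1 hn
    rw [Real.log_pow] at this
    linarith
  have hn2 : Real.log (n + 2) ≤ 2 * Real.log |Real.log R| := by
    have h1 : Real.log (n + 2) ≤ Real.log (|Real.log R| ^ 2) :=
      Real.log_le_log (by positivity) (by linarith)
    rw [Real.log_pow] at h1
    exact_mod_cast h1
  have hceil : ((⌈c * Real.log (n + 2)⌉₊ + 1 : ℕ) : ℝ) ≤ (2 * c + 1) * Real.log |Real.log R| := by
    have h0 : 0 ≤ Real.log ((n : ℝ) + 2) :=
      Real.log_nonneg (by have : (0 : ℝ) ≤ n := n.cast_nonneg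
                          linarith)
    have h1 := (Nat.ceil_lt_add_one (mul_nonneg hc h0)).le
    have h2 := mul_le_mul_of_nonneg_left hn2 hc
    push_cast
    linarith
  rw [Real.rpow_def_of_pos hR6.1, ← Real.exp_log (pow_pos F.A_pos _), Real.log_pow]
  refine Real.exp_le_exp.2 ?_
  have hexp : Real.log R * Φ R = -(H R * Real.log |Real.log R|) := by
    rw [hR1, habs]
    have : Real.log R ≠ 0 := hlogR.ne
    field_simp
  rw [hexp]
  have h1 := mul_le_mul_of_nonneg_right hceil (neg_pos.2 hA).le
  have h2 := mul_le_mul_of_nonneg_right hR2 (by linarith : 0 ≤ Real.log |Real.log R|)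
  linarith

variable {ω} in
/-- If over all windows which are long compared with the logarithm of their starting step the sums
of the potential for the exponent `d` are bounded above, the upper dimension is at most `d`. -/
theorem upperPhiDim_le {Φ : ℝ → ℝ} (hΦ : IsLargeDimensionFunction Φ)
    (hω : ∀ k j, 0 < (ω k).2 j) {d c M : ℝ} (hd : 0 ≤ d) (hc : 0 ≤ c)
    (hM : ∀ n m : ℕ, ⌈c * Real.log (n + 1)⌉₊ ≤ m →
      ∑ k ∈ Finset.range m, F.potential d (ω (n + k)) ≤ M) :
    upperPhiDim Φ (F.randomMeasure ω) ≤ d := by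
  refine sInf_le ⟨d, ?_, rfl⟩
  obtain ⟨ε, hε, hev⟩ := mem_nhdsGT_iff_exists_Ioo_subset.1 (F.eventually_rpow_le hΦ c hc)
  have hε0 : 0 < ε := hε
  have hτA : 0 < F.τ * F.A := mul_pos F.τ_pos F.A_pos
  refine ⟨min (ε / 2) F.τ, lt_min (half_pos hε0) F.τ_pos, (F.τ * F.A)⁻¹ ^ d * Real.exp M,
    mul_pos (Real.rpow_pos_of_pos (inv_pos.2 hτA) _) (Real.exp_pos _), ?_⟩
  intro r R hr hrR hRR hRC hR1 x hx
  obtain ⟨i, rfl⟩ := F.support_subset_range_coding ω hx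
  have hR0 : 0 < R := hr.trans (hrR.trans_le hRR)
  have hRε : R < ε := (hRC.trans (min_le_left _ _)).trans_lt (half_lt_self hε0)
  have hRτ : R / F.τ ≤ 1 := (div_le_one F.τ_pos).2 (hRC.trans (min_le_right _ _))
  obtain ⟨n, hn1, hn2⟩ := F.exists_scale_lt_le ω i (div_pos hR0 F.τ_pos) hRτ
  obtain ⟨m, hm1, hm2⟩ := F.exists_scale_lt_le ω i hr ((hrR.le.trans hRR).trans hR1.le)
  rw [lt_div_iff₀' F.τ_pos] at hn1
  rw [div_le_iff₀' F.τ_pos] at hn2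
  have hRn : R ≤ F.scale ω i n :=
    hn2.trans (mul_le_of_le_one_left (F.scale_pos ω i n).le F.tau_lt_one.le)
  -- the radius `R` sits at step `n + 1`, the radius `r` at step `m + 1`, and the window between
  -- them is long
  set l := ⌈c * Real.log (n + 2)⌉₊ with hl
  have hpow : R ^ Φ R ≤ F.A ^ (l + 1) := hev ⟨hR0, hRε⟩ n (hRn.trans (F.scale_le_pow ω i n))
  have hlong : n + 1 + l ≤ m + 1 := by
    by_contra! hlt
    have h1 : F.scale ω i (n + (l + 1)) ≤ F.scale ω i (m + 1) :=
      F.antitone_scale ω i (by omega)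
    have h2 := F.mul_pow_le_scale_add ω i n (l + 1)
    have h3 : R ^ (1 + Φ R) ≤ F.scale ω i n * F.A ^ (l + 1) := by
      rw [Real.rpow_add hR0, Real.rpow_one]
      exact mul_le_mul hRn hpow (Real.rpow_nonneg hR0.le _) (F.scale_pos ω i n).le
    linarith
  obtain ⟨q, hq⟩ := Nat.exists_eq_add_of_le (show n + 1 ≤ m + 1 by omega)
  have hS := hM (n + 1) q (by
    have : ((n + 1 : ℕ) : ℝ) + 1 = n + 2 := by push_cast; ring
    rw [this, ← hl]
    omega)
  have hball : (F.randomMeasure ω).real (Metric.ball (F.coding ω i) R) ≤ mass ω i (n + 1) :=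
    F.real_ball_le_mass ω i hn2
  have hball' : mass ω i (m + 1) ≤ (F.randomMeasure ω).real (Metric.ball (F.coding ω i) r) :=
    F.mass_le_real_ball ω i hm1
  have hscale : F.scale ω i (n + 1) / F.scale ω i (m + 1) ≤ (F.τ * F.A)⁻¹ * (R / r) := by
    have h1 := F.mul_pow_le_scale_add ω i m 1
    rw [pow_one] at h1
    have h2 : r * F.A ≤ F.scale ω i (m + 1) :=
      (mul_le_mul_of_nonneg_right hm2 F.A_pos.le).trans h1
    have h3 : (F.τ * F.A)⁻¹ * (R / r) = R / F.τ / (r * F.A) := by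
      have := F.τ_pos.ne'
      have := F.A_pos.ne'
      field_simp
    rw [h3]
    refine div_le_div₀ (div_pos hR0 F.τ_pos).le ?_ (mul_pos hr F.A_pos) h2
    rw [le_div_iff₀' F.τ_pos]
    exact hn1.le
  have hmass := mass_pos i hω (m + 1)
  have hloss := F.mass_le_exp_mul i hω d (n + 1) q
  rw [← hq] at hloss
  rw [div_le_iff₀ (hmass.trans_le hball')]
  have hRr : 0 ≤ (R / r) ^ d := Real.rpow_nonneg (div_pos hR0 hr).le _
  have hscale' : (F.scale ω i (n + 1) / F.scale ω i (m + 1)) ^ d ≤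
      (F.τ * F.A)⁻¹ ^ d * (R / r) ^ d := by
    rw [← Real.mul_rpow (inv_pos.2 hτA).le (div_pos hR0 hr).le]
    exact Real.rpow_le_rpow (div_pos (F.scale_pos ω i _) (F.scale_pos ω i _)).le hscale hd
  have hfac : 0 ≤ (F.τ * F.A)⁻¹ ^ d * (R / r) ^ d :=
    mul_nonneg (Real.rpow_nonneg (inv_pos.2 hτA).le _) hRr
  calc _ ≤ mass ω i (n + 1) := hball
    _ ≤ _ := hloss
    _ ≤ mass ω i (m + 1) * ((F.τ * F.A)⁻¹ ^ d * (R / r) ^ d) * Real.exp M :=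
        mul_le_mul (mul_le_mul_of_nonneg_left hscale' hmass.le) (Real.exp_le_exp.2 hS)
          (Real.exp_pos _).le (mul_nonneg hmass.le hfac)
    _ = (F.τ * F.A)⁻¹ ^ d * Real.exp M * (R / r) ^ d * mass ω i (m + 1) := by ring
    _ ≤ _ := mul_le_mul_of_nonneg_left hball'
        (mul_nonneg (mul_pos (Real.rpow_pos_of_pos (inv_pos.2 hτA) _) (Real.exp_pos _)).le hRr)

/-- An address which at each step realizes the maximum in the potential. -/
theorem exists_address_eq_exp (hω : ∀ k j, 0 < (ω k).2 j) (d : ℝ) :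
    ∃ i : ℕ → Fin K, ∀ n, F.scale ω i n ^ d =
      mass ω i n * Real.exp (∑ k ∈ Finset.range n, F.potential d (ω k)) := by
  choose i hi using fun k => F.exists_eq_potential d (ω k)
  refine ⟨i, fun n => ?_⟩
  rw [Real.exp_sum, mass, scale, ← Finset.prod_mul_distrib,
    ← Real.finsetProd_rpow _ _ fun k _ => (F.ratio_pos _ _).le]
  refine Finset.prod_congr rfl fun k _ => ?_
  rw [← hi k, Real.rpow_def_of_pos (F.ratio_pos _ _)]
  rw [Real.exp_sub, Real.exp_log (hω k (i k)), mul_div_cancel₀ _ (hω k (i k)).ne', mul_comm]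

variable {ω} in
/-- If the sums of the potential for the exponent `d` tend to infinity, the upper dimension is at
least `d`: compare a fixed ball around the point with the worst address with its small balls. -/
theorem le_upperPhiDim {Φ : ℝ → ℝ} (hΦ : IsDimensionFunction Φ)
    (hω : ∀ k j, 0 < (ω k).2 j) {d : ℝ} (hd : 0 ≤ d)
    (hS : Tendsto (fun n => ∑ k ∈ Finset.range n, F.potential d (ω k)) atTop atTop) :
    (d : EReal) ≤ upperPhiDim Φ (F.randomMeasure ω) := by
  refine le_sInf ?_
  rintro _ ⟨e, ⟨C₁, hC₁, C₂, hC₂, hbound⟩, rfl⟩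
  rw [EReal.coe_le_coe_iff]
  by_contra! hed
  obtain ⟨i, hi⟩ := F.exists_address_eq_exp ω hω d
  set R : ℝ := min C₁ (1 / 2) with hR
  have hR0 : 0 < R := lt_min hC₁ (by norm_num)
  have hR1 : R < 1 := (min_le_right _ _).trans_lt (by norm_num)
  have hRΦ : R ^ (1 + Φ R) ≤ R := by
    have h1 := hΦ.nonneg R ⟨hR0, hR1⟩
    calc R ^ (1 + Φ R) ≤ R ^ (1 : ℝ) :=
          Real.rpow_le_rpow_of_exponent_ge hR0 hR1.le (by linarith)
      _ = R := Real.rpow_one R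
  obtain ⟨n₀, hn₀⟩ := ((F.tendsto_scale ω i).eventually (gt_mem_nhds hR0)).exists
  have hm₀ := F.mass_le_real_ball ω i hn₀
  have hm₀' := mass_pos i hω n₀
  have hsmall : Tendsto (fun n => F.τ * F.scale ω i n) atTop (𝓝 0) := by
    simpa using (F.tendsto_scale ω i).const_mul F.τ
  have hexp := Real.tendsto_exp_atTop.comp (hS.comp (tendsto_add_atTop_nat 1))
  obtain ⟨n, hn1, hn2⟩ := ((hsmall.eventually
    (gt_mem_nhds (Real.rpow_pos_of_pos hR0 (1 + Φ R)))).and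
    (hexp.eventually_gt_atTop (C₂ * (R / F.τ) ^ d / mass ω i n₀))).exists
  simp only [Function.comp_apply] at hn2
  have hr0 : 0 < F.τ * F.scale ω i n := mul_pos F.τ_pos (F.scale_pos ω i n)
  have hb := hbound _ R hr0 hn1 hRΦ (min_le_left _ _) hR1 _ (F.coding_mem_support i hω)
  have hone : 1 ≤ R / (F.τ * F.scale ω i n) := (one_le_div hr0).2 (hn1.le.trans hRΦ)
  have hb2 : F.scale ω i (n + 1) ≤ F.scale ω i n := F.antitone_scale ω i n.le_succ
  have hb3 : R / (F.τ * F.scale ω i n) ≤ R / F.τ / F.scale ω i (n + 1) := by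
    rw [div_mul_eq_div_div]
    exact div_le_div_of_nonneg_left (div_pos hR0 F.τ_pos).le (F.scale_pos ω i _) hb2
  -- since `R / r ≥ 1`, the inequality for the exponent `e < d` implies the one for `d`
  have hpow : (R / (F.τ * F.scale ω i n)) ^ e ≤ (R / F.τ) ^ d / F.scale ω i (n + 1) ^ d := by
    rw [← Real.div_rpow (div_pos hR0 F.τ_pos).le (F.scale_pos ω i _).le]
    exact (Real.rpow_le_rpow_of_exponent_le hone hed.le).trans
      (Real.rpow_le_rpow (zero_le_one.trans hone) hb3 hd)
  have hballr : (F.randomMeasure ω).real (Metric.ball (F.coding ω i) (F.τ * F.scale ω i n)) ≤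
      mass ω i (n + 1) := F.real_ball_le_mass ω i le_rfl
  have hballr0 : 0 < (F.randomMeasure ω).real
      (Metric.ball (F.coding ω i) (F.τ * F.scale ω i n)) := by
    obtain ⟨l, hl⟩ := ((F.tendsto_scale ω i).eventually (gt_mem_nhds hr0)).exists
    exact (mass_pos i hω l).trans_le (F.mass_le_real_ball ω i hl)
  have hM := mass_pos i hω (n + 1)
  have h1 : mass ω i n₀ / mass ω i (n + 1) ≤ C₂ * ((R / F.τ) ^ d / F.scale ω i (n + 1) ^ d) :=
    (div_le_div₀ measureReal_nonneg hm₀ hballr0 hballr).trans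
      (hb.trans (mul_le_mul_of_nonneg_left hpow hC₂.le))
  rw [hi (n + 1)] at h1
  rw [div_lt_iff₀ hm₀'] at hn2
  rw [div_le_iff₀ hM] at h1
  have h2 : C₂ * ((R / F.τ) ^ d / (mass ω i (n + 1) *
      Real.exp (∑ k ∈ Finset.range (n + 1), F.potential d (ω k)))) * mass ω i (n + 1) =
      C₂ * (R / F.τ) ^ d / Real.exp (∑ k ∈ Finset.range (n + 1), F.potential d (ω k)) := by
    field_simp
  rw [h2, le_div_iff₀ (Real.exp_pos _)] at h1
  linarith

end MoranFamily

/-! ### Sums of independent variables over windows -/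

section Windows

variable {Z : Type*} [MeasurableSpace Z] {P : Measure Z} [IsProbabilityMeasure P] {f : Z → ℝ}

theorem identDistrib_infinitePi_eval (hf : Measurable f) (n : ℕ) :
    IdentDistrib (fun ω : ℕ → Z => f (ω n)) f (Measure.infinitePi fun _ : ℕ => P) P where
  aemeasurable_fst := (hf.comp (measurable_pi_apply n)).aemeasurable
  aemeasurable_snd := hf.aemeasurable
  map_eq := by
    have h := Measure.infinitePi_map_eval (fun _ : ℕ => P) n
    conv_rhs => rw [← h, Measure.map_map hf (measurable_pi_apply n)]
    rfl

theorem lintegral_exp_mul_window (hf : Measurable f) {s : ℝ}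
    (hint : Integrable (fun z => Real.exp (s * f z)) P) (n m : ℕ) :
    ∫⁻ ω, ENNReal.ofReal (Real.exp (s * ∑ k ∈ Finset.range m, f (ω (n + k))))
      ∂(Measure.infinitePi fun _ : ℕ => P) = ENNReal.ofReal (mgf f P s ^ m) := by
  have hindep : iIndepFun (fun (k : ℕ) (ω : ℕ → Z) => f (ω (n + k)))
      (Measure.infinitePi fun _ : ℕ => P) :=
    (iIndepFun_infinitePi (P := fun _ : ℕ => P) (X := fun _ => f) fun _ => hf).precomp
      (add_right_injective n)
  have hmeas : ∀ k, Measurable fun ω : ℕ → Z => f (ω (n + k)) := fun k =>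
    hf.comp (measurable_pi_apply _)
  have hid : ∀ k, IdentDistrib (fun ω : ℕ → Z => Real.exp (s * f (ω k)))
      (fun z => Real.exp (s * f z)) (Measure.infinitePi fun _ : ℕ => P) P := fun k =>
    (identDistrib_infinitePi_eval hf k).comp (u := fun x => Real.exp (s * x)) (by fun_prop)
  have hI := hindep.integrable_exp_mul_sum (t := s) hmeas (s := Finset.range m)
    fun k _ => (hid (n + k)).integrable_iff.2 hint
  have hM := hindep.mgf_sum (t := s) hmeas (Finset.range m)
  have hM' : ∀ k, mgf (fun ω : ℕ → Z => f (ω (n + k))) (Measure.infinitePi fun _ : ℕ => P) s =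
      mgf f P s := fun k => (hid (n + k)).integral_eq
  simp only [hM', Finset.prod_const, Finset.card_range] at hM
  rw [← hM, mgf, ofReal_integral_eq_lintegral_ofReal hI
    (Eventually.of_forall fun _ => (Real.exp_pos _).le)]
  simp only [Finset.sum_apply]

/-- If some exponential moment has expectation below one, then almost surely the sums over all
windows whose length exceeds a multiple of the logarithm of their starting place are bounded above
together: the expectation of the sum of all the exponentials is finite. -/
theorem exists_ae_window_sum_le (hf : Measurable f) {s : ℝ} (hs : 0 < s)
    (hint : Integrable (fun z => Real.exp (s * f z)) P) (hlt : mgf f P s < 1) :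
    ∃ c : ℝ, 0 ≤ c ∧ ∀ᵐ ω ∂(Measure.infinitePi fun _ : ℕ => P), ∃ M : ℝ, ∀ n m : ℕ,
      ⌈c * Real.log (n + 1)⌉₊ ≤ m → ∑ k ∈ Finset.range m, f (ω (n + k)) ≤ M := by
  set ρ := mgf f P s with hρ
  have hρ0 : 0 < ρ := mgf_pos hint
  have hlog : Real.log ρ < 0 := Real.log_neg hρ0 hlt
  -- with this choice `ρ ^ (c * log (n + 1)) = (n + 1) ^ (-2)`
  set c : ℝ := 2 / -Real.log ρ with hc
  have hc0 : 0 ≤ c := div_nonneg zero_le_two (by linarith)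
  refine ⟨c, hc0, ?_⟩
  set N : ℕ → ℕ := fun n => ⌈c * Real.log (n + 1)⌉₊ with hN
  have hpow : ∀ n : ℕ, ρ ^ N n ≤ 1 / ((n : ℝ) + 1) ^ 2 := by
    intro n
    have hn : (0 : ℝ) < (n : ℝ) + 1 := n.cast_add_one_pos
    rw [← Real.exp_log (pow_pos hρ0 _), ← Real.exp_log (div_pos one_pos (pow_pos hn 2)),
      Real.log_pow, one_div, Real.log_inv, Real.log_pow]
    refine Real.exp_le_exp.2 ?_
    have h1 : c * Real.log (n + 1) ≤ N n := Nat.le_ceil _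
    have h2 := mul_le_mul_of_nonpos_right h1 hlog.le
    have h3 : c * Real.log (n + 1) * Real.log ρ = -(2 * Real.log (n + 1)) := by
      have := hlog.ne
      rw [hc]
      field_simp
    push_cast
    linarith
  have hsum : Summable fun q : ℕ × ℕ => ρ ^ (N q.1 + q.2) := by
    have h1 : Summable fun n : ℕ => 1 / ((n : ℝ) + 1) ^ 2 := by
      have := (summable_nat_add_iff 1).2 (Real.summable_one_div_nat_pow.2 one_lt_two)
      simpa using this
    have h2 : Summable fun n : ℕ => ρ ^ N n :=
      Summable.of_nonneg_of_le (fun n => (pow_pos hρ0 _).le) hpow h1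
    refine (h2.mul_of_nonneg (summable_geometric_of_lt_one hρ0.le hlt)
      (fun n => (pow_pos hρ0 _).le) fun n => (pow_pos hρ0 _).le).congr fun q => ?_
    rw [pow_add]
  have hmeas : ∀ q : ℕ × ℕ, Measurable fun ω : ℕ → Z => ENNReal.ofReal
      (Real.exp (s * ∑ k ∈ Finset.range (N q.1 + q.2), f (ω (q.1 + k)))) := fun q =>
    ((Finset.measurable_sum _ fun k _ =>
      hf.comp (measurable_pi_apply _)).const_mul s).exp.ennreal_ofReal
  have hfin : ∫⁻ ω, ∑' q : ℕ × ℕ, ENNReal.ofReal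
      (Real.exp (s * ∑ k ∈ Finset.range (N q.1 + q.2), f (ω (q.1 + k))))
      ∂(Measure.infinitePi fun _ : ℕ => P) ≠ ∞ := by
    rw [lintegral_tsum fun q => (hmeas q).aemeasurable]
    simp only [lintegral_exp_mul_window hf hint]
    exact hsum.tsum_ofReal_ne_top
  filter_upwards [ae_lt_top (Measurable.tsum hmeas) hfin] with ω hω
  set T := ∑' q : ℕ × ℕ, ENNReal.ofReal
    (Real.exp (s * ∑ k ∈ Finset.range (N q.1 + q.2), f (ω (q.1 + k)))) with hT
  refine ⟨T.toReal / s, fun n m hnm => ?_⟩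
  obtain ⟨l, rfl⟩ := Nat.exists_eq_add_of_le hnm
  have h1 : ENNReal.ofReal (Real.exp (s * ∑ k ∈ Finset.range (N n + l), f (ω (n + k)))) ≤ T :=
    ENNReal.le_tsum (f := fun q : ℕ × ℕ => ENNReal.ofReal
      (Real.exp (s * ∑ k ∈ Finset.range (N q.1 + q.2), f (ω (q.1 + k))))) (n, l)
  have h2 := (ENNReal.ofReal_le_iff_le_toReal hω.ne).1 h1
  rw [le_div_iff₀ hs]
  have h3 := Real.add_one_le_exp (s * ∑ k ∈ Finset.range (N n + l), f (ω (n + k)))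
  change (∑ k ∈ Finset.range (N n + l), f (ω (n + k))) * s ≤ T.toReal
  linarith

theorem ae_tendsto_sum_atTop (hf : Measurable f) (hint : Integrable f P)
    (hpos : 0 < ∫ z, f z ∂P) :
    ∀ᵐ ω ∂(Measure.infinitePi fun _ : ℕ => P),
      Tendsto (fun n => ∑ k ∈ Finset.range n, f (ω k)) atTop atTop := by
  have hindep : iIndepFun (fun (k : ℕ) (ω : ℕ → Z) => f (ω k))
      (Measure.infinitePi fun _ : ℕ => P) :=
    iIndepFun_infinitePi (P := fun _ : ℕ => P) (X := fun _ => f) fun _ => hf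
  have hid := identDistrib_infinitePi_eval (P := P) hf
  have hlaw := strong_law_ae (fun (k : ℕ) (ω : ℕ → Z) => f (ω k)) ((hid 0).integrable_iff.2 hint)
    (fun _ _ hij => hindep.indepFun hij) fun k => (hid k).trans (hid 0).symm
  filter_upwards [hlaw] with ω hω
  have h0 : ∫ ω, f (ω 0) ∂(Measure.infinitePi fun _ : ℕ => P) = ∫ z, f z ∂P := (hid 0).integral_eq
  rw [h0] at hω
  refine (tendsto_natCast_atTop_atTop.atTop_mul_pos hpos hω).congr' ?_
  filter_upwards [eventually_ne_atTop 0] with n hn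
  rw [smul_eq_mul, mul_inv_cancel_left₀ (Nat.cast_ne_zero.2 hn)]

end Windows

namespace MoranFamily

variable {K : ℕ} {𝒜 : Type*} [MeasurableSpace 𝒜] {𝒬 : Measure 𝒜} [IsProbabilityMeasure 𝒬]
  {ℛ : Measure (Weights K)}

/-! ### The almost sure upper dimension -/

theorem ae_forall_weight_pos (hℛ : IsAdmissible ℛ) :
    ∀ᵐ ω ∂(Measure.infinitePi fun _ : ℕ => 𝒬.prod ℛ), ∀ k j, 0 < (ω k).2 j := by
  have := hℛ.1
  refine ae_all_iff.2 fun k => ?_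
  have h1 : ∀ᵐ z ∂𝒬.prod ℛ, ∀ j, 0 < z.2 j :=
    Measure.quasiMeasurePreserving_snd.ae hℛ.exists_integrable_rpow.1
  exact (measurePreserving_eval_infinitePi (fun _ : ℕ => 𝒬.prod ℛ) k).quasiMeasurePreserving.ae h1

theorem ae_upperPhiDim_le (F : MoranFamily K 𝒜) (hℛ : IsAdmissible ℛ) {Φ : ℝ → ℝ}
    (hΦ : IsLargeDimensionFunction Φ) {d : ℝ} (hd : 0 ≤ d) (hneg : F.pressure 𝒬 ℛ d < 0) :
    ∀ᵐ ω ∂(Measure.infinitePi fun _ : ℕ => 𝒬.prod ℛ),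
      upperPhiDim Φ (F.randomMeasure ω) ≤ d := by
  have := hℛ.1
  obtain ⟨s, hs, hint, hlt⟩ := F.exists_mgf_potential_lt_one hℛ hd hneg
  obtain ⟨c, hc, hae⟩ := exists_ae_window_sum_le (F.measurable_potential d) hs hint hlt
  filter_upwards [hae, ae_forall_weight_pos hℛ] with ω ⟨M, hM⟩ hω
  exact F.upperPhiDim_le hΦ hω hd hc hM

theorem ae_le_upperPhiDim (F : MoranFamily K 𝒜) (hℛ : IsAdmissible ℛ) {Φ : ℝ → ℝ}
    (hΦ : IsDimensionFunction Φ) {d : ℝ} (hd : 0 ≤ d) (hpos : 0 < F.pressure 𝒬 ℛ d) :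
    ∀ᵐ ω ∂(Measure.infinitePi fun _ : ℕ => 𝒬.prod ℛ),
      d ≤ upperPhiDim Φ (F.randomMeasure ω) := by
  have := hℛ.1
  filter_upwards [ae_tendsto_sum_atTop (F.measurable_potential d) (F.integrable_potential hℛ hd)
    hpos, ae_forall_weight_pos hℛ] with ω hω hω'
  exact F.le_upperPhiDim hΦ hω' hd hω

/-- The almost sure upper dimension is the zero of the pressure. -/
theorem hasUpperDim_of_pressure_eq_zero (F : MoranFamily K 𝒜) (hℛ : IsAdmissible ℛ) {α : ℝ}
    (hα : 0 < α) (hα0 : F.pressure 𝒬 ℛ α = 0) {Φ : ℝ → ℝ} (hΦ : IsLargeDimensionFunction Φ) :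
    F.HasUpperDim 𝒬 ℛ Φ α := by
  have hB := F.log_B_neg
  have hle : ∀ᵐ ω ∂(Measure.infinitePi fun _ : ℕ => 𝒬.prod ℛ), ∀ q : ℚ, α < q →
      upperPhiDim Φ (F.randomMeasure ω) ≤ (q : ℝ) := by
    refine ae_all_iff.2 fun q => ?_
    by_cases hq : α < q
    · have h1 := F.pressure_le_add (𝒬 := 𝒬) hℛ hα.le hq.le
      have h2 := mul_neg_of_pos_of_neg (sub_pos.2 hq) hB
      filter_upwards [F.ae_upperPhiDim_le hℛ hΦ (hα.le.trans hq.le) (by linarith)] with ω hω _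
      exact hω
    · exact Eventually.of_forall fun ω h => absurd h hq
  have hge : ∀ᵐ ω ∂(Measure.infinitePi fun _ : ℕ => 𝒬.prod ℛ), ∀ q : ℚ, 0 ≤ (q : ℝ) →
      q < α → (q : ℝ) ≤ upperPhiDim Φ (F.randomMeasure ω) := by
    refine ae_all_iff.2 fun q => ?_
    by_cases hq : 0 ≤ (q : ℝ) ∧ q < α
    · have h1 := F.pressure_le_add (𝒬 := 𝒬) hℛ hq.1 hq.2.le
      have h2 := mul_neg_of_pos_of_neg (sub_pos.2 hq.2) hB
      filter_upwards [F.ae_le_upperPhiDim hℛ hΦ.toIsDimensionFunction hq.1 (by linarith)]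
        with ω hω _ _
      exact hω
    · exact Eventually.of_forall fun ω h h' => absurd ⟨h, h'⟩ hq
  filter_upwards [hle, hge] with ω h1 h2
  refine le_antisymm (not_lt.1 fun hlt => ?_) (not_lt.1 fun hlt => ?_)
  · obtain ⟨q, hq1, hq2⟩ := EReal.lt_iff_exists_rat_btwn.1 hlt
    exact absurd (h1 q (EReal.coe_lt_coe_iff.1 hq1)) (not_le.2 hq2)
  · obtain ⟨q, hq1, hq2⟩ := EReal.lt_iff_exists_rat_btwn.1 hlt
    rcases le_or_gt 0 (q : ℝ) with hq | hq
    · exact absurd (h2 q hq (EReal.coe_lt_coe_iff.1 hq2)) (not_le.2 hq1)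
    · have h3 := h2 0 (by simp) (by simpa using hα)
      have h4 : ((q : ℝ) : EReal) < ((0 : ℚ) : ℝ) := EReal.coe_lt_coe_iff.2 (by simpa using hq)
      exact absurd (h3.trans_lt hq1) (not_lt.2 h4.le)

theorem HasUpperDim.unique {F : MoranFamily K 𝒜} [IsProbabilityMeasure ℛ] {Φ : ℝ → ℝ}
    {α β : EReal} (hα : F.HasUpperDim 𝒬 ℛ Φ α) (hβ : F.HasUpperDim 𝒬 ℛ Φ β) : α = β := by
  obtain ⟨ω, h1, h2⟩ := (Filter.Eventually.and hα hβ).exists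
  exact h1.symm.trans h2

/-! ### Minimizing over the distribution of the weights -/

/-- The pressure is strictly decreasing, so its sign at the zero for another distribution orders
the zeros. -/
theorem le_of_pressure_nonneg (F : MoranFamily K 𝒜) (hℛ : IsAdmissible ℛ) {α β : ℝ} (hα : 0 ≤ α)
    (hα0 : F.pressure 𝒬 ℛ α ≤ 0) (hβ0 : 0 ≤ F.pressure 𝒬 ℛ β) : β ≤ α := by
  by_contra! h
  have h1 := F.pressure_le_add (𝒬 := 𝒬) hℛ hα h.le
  have h2 := mul_neg_of_pos_of_neg (sub_pos.2 h) F.log_B_neg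
  linarith

theorem pressure_dirac (F : MoranFamily K 𝒜) (p : Weights K) (d : ℝ) :
    F.pressure 𝒬 (Measure.dirac p) d = ∫ u, F.potential d (u, p) ∂𝒬 := by
  rw [pressure, Measure.prod_dirac, integral_map (by fun_prop)
    (F.measurable_potential d).aestronglyMeasurable]

theorem integrable_potential_dirac (F : MoranFamily K 𝒜) {p : Weights K} (hp : IsValidWeight p)
    {d : ℝ} (hd : 0 ≤ d) : Integrable (fun u => F.potential d (u, p)) 𝒬 := by
  have h1 := F.integrable_potential (𝒬 := 𝒬) hp.isAdmissible_dirac hd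
  rw [Measure.prod_dirac] at h1
  exact (integrable_map_measure (F.measurable_potential d).aestronglyMeasurable
    (by fun_prop)).1 h1

/-- The normalized vector of geometric means of the weights. By Jensen's inequality, for the
maximum in the potential and for the logarithm, its pressure is at most that of `ℛ`. -/
theorem exists_pressure_dirac_le (F : MoranFamily K 𝒜) (𝒬 : Measure 𝒜) [IsProbabilityMeasure 𝒬]
    (hℛ : IsAdmissible ℛ) :
    ∃ p : Weights K, IsValidWeight p ∧
      ∀ d : ℝ, 0 ≤ d → F.pressure 𝒬 (Measure.dirac p) d ≤ F.pressure 𝒬 ℛ d := by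
  have := hℛ.1
  have := F.fin_nonempty
  have hpos := hℛ.exists_integrable_rpow.1
  have hlog : ∀ i, Integrable (fun p : Weights K => Real.log (p i)) ℛ := by
    intro i
    obtain ⟨hpos, t, ht, hint⟩ := hℛ.exists_integrable_rpow
    refine ((hint i).div_const t).mono' (measurable_weight_apply i).log.aestronglyMeasurable ?_
    filter_upwards [hpos] with p hp
    have h1 := Real.log_nonpos (weight_nonneg p i) (weight_le_one p i)
    have h2 := Real.log_le_sub_one_of_pos (Real.rpow_pos_of_pos (hp i) (-t))
    rw [Real.log_rpow (hp i)] at h2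
    rw [Real.norm_eq_abs, abs_of_nonpos h1, le_div_iff₀ ht]
    linarith
  set g : Fin K → ℝ := fun i => Real.exp (∫ p, Real.log (p i) ∂ℛ) with hg
  have hg0 : ∀ i, 0 < g i := fun i => Real.exp_pos _
  have hint1 : ∀ i, Integrable (fun p : Weights K => p i) ℛ := fun i =>
    (integrable_const (1 : ℝ)).mono' (measurable_weight_apply i).aestronglyMeasurable
      (Eventually.of_forall fun p => by
        rw [Real.norm_of_nonneg (weight_nonneg p i)]; exact weight_le_one p i)
  have hg1 : ∀ i, g i ≤ ∫ p, p i ∂ℛ := by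
    intro i
    have hexp : (fun p : Weights K => Real.exp (Real.log (p i))) =ᵐ[ℛ] fun p => p i := by
      filter_upwards [hpos] with p hp using Real.exp_log (hp i)
    rw [← integral_congr_ae hexp]
    exact convexOn_exp.map_integral_le Real.continuous_exp.continuousOn isClosed_univ
      (Eventually.of_forall fun _ => Set.mem_univ _) (hlog i)
      ((integrable_congr hexp).2 (hint1 i))
  have hsum0 : 0 < ∑ i, g i := Finset.sum_pos (fun i _ => hg0 i) Finset.univ_nonempty
  have hsum1 : ∑ i, g i ≤ 1 := by
    calc ∑ i, g i ≤ ∑ i, ∫ p, p i ∂ℛ := Finset.sum_le_sum fun i _ => hg1 i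
      _ = ∫ p : Weights K, ∑ i, p i ∂ℛ := (integral_finsetSum _ fun i _ => hint1 i).symm
      _ = 1 := by simp only [sum_weight, integral_const, probReal_univ, one_smul]
  let p : Weights K := ⟨fun i => g i / ∑ j, g j, fun i => (div_pos (hg0 i) hsum0).le, by
    rw [← Finset.sum_div, div_self hsum0.ne']⟩
  have hpi : ∀ i, g i ≤ p i := fun i => le_div_self (hg0 i).le hsum0 hsum1
  have hpv : IsValidWeight p := fun i => ((hg0 i).trans_le (hpi i)).ne'
  refine ⟨p, hpv, fun d hd => ?_⟩
  have hI := F.integrable_potential (𝒬 := 𝒬) hℛ hd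
  rw [pressure_dirac, pressure, integral_prod _ hI]
  refine integral_mono_ae (F.integrable_potential_dirac hpv hd) hI.integral_prod_left ?_
  filter_upwards [hI.prod_right_ae] with u hu
  refine F.potential_le fun i => ?_
  have h1 : ∫ q, (d * Real.log (F.ratio u i) - Real.log (q i)) ∂ℛ ≤
      ∫ q, F.potential d (u, q) ∂ℛ :=
    integral_mono ((integrable_const _).sub (hlog i)) hu fun q => F.le_potential d (u, q) i
  rw [integral_sub (integrable_const _) (hlog i), integral_const, probReal_univ, one_smul] at h1
  have h2 := Real.log_le_log (hg0 i) (hpi i)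
  rw [hg, Real.log_exp] at h2
  exact (sub_le_sub_left h2 _).trans h1

theorem pressure_dirac_le_add (F : MoranFamily K 𝒜) {p q : Weights K} (hp : IsValidWeight p)
    (hq : IsValidWeight q) {d ε : ℝ} (hd : 0 ≤ d)
    (h : ∀ i, Real.log (p i) ≤ Real.log (q i) + ε) :
    F.pressure 𝒬 (Measure.dirac q) d ≤ F.pressure 𝒬 (Measure.dirac p) d + ε := by
  have h1 : ∫ u, F.potential d (u, q) ∂𝒬 ≤ ∫ u, (F.potential d (u, p) + ε) ∂𝒬 := by
    refine integral_mono (F.integrable_potential_dirac hq hd)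
      ((F.integrable_potential_dirac hp hd).add (integrable_const _)) fun u => ?_
    refine F.potential_le fun i => ?_
    have h2 := F.le_potential d (u, p) i
    have h3 := h i
    dsimp only at h2 ⊢
    linarith
  rw [integral_add (F.integrable_potential_dirac hp hd) (integrable_const _), integral_const,
    probReal_univ, one_smul] at h1
  rwa [pressure_dirac, pressure_dirac]

/-- The zero of the pressure is a Lipschitz function of the logarithms of the weights. -/
theorem pressure_zero_le_add (F : MoranFamily K 𝒜) {p q : Weights K} (hp : IsValidWeight p)
    (hq : IsValidWeight q) {α β ε : ℝ} (hα : 0 < α) (hα0 : F.pressure 𝒬 (Measure.dirac p) α = 0)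
    (hβ0 : F.pressure 𝒬 (Measure.dirac q) β = 0) (hε : 0 ≤ ε)
    (h : ∀ i, Real.log (p i) ≤ Real.log (q i) + ε * -Real.log F.B) : β ≤ α + ε := by
  have h1 := F.pressure_dirac_le_add (𝒬 := 𝒬) hp hq hα.le h
  have h2 := F.pressure_le_add (𝒬 := 𝒬) hq.isAdmissible_dirac hα.le
    (le_add_of_nonneg_right hε : α ≤ α + ε)
  refine F.le_of_pressure_nonneg (𝒬 := 𝒬) hq.isAdmissible_dirac (by linarith) ?_ hβ0.ge
  rw [add_sub_cancel_left] at h2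
  linarith

theorem rpow_le_weight (F : MoranFamily K 𝒜) {p : Weights K} (hp : IsValidWeight p) {α : ℝ}
    (hα : 0 < α) (hα0 : F.pressure 𝒬 (Measure.dirac p) α = 0) (i : Fin K) : F.A ^ α ≤ p i := by
  have h1 : ∫ _u, (-Real.log (p i) + α * Real.log F.A) ∂𝒬 ≤ ∫ u, F.potential α (u, p) ∂𝒬 :=
    integral_mono (integrable_const _) (F.integrable_potential_dirac hp hα.le) fun u => by
      have h2 := F.neg_log_weight_le hα.le (u, p) i
      dsimp only at h2 ⊢
      linarith
  rw [← pressure_dirac, hα0, integral_const, probReal_univ, one_smul] at h1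
  rw [Real.rpow_def_of_pos F.A_pos, ← Real.le_log_iff_exp_le (hp.pos i)]
  linarith

/-- Some valid weight vector minimizes the zero of the pressure. A bound for the zero keeps the
weights away from `0`, so the minimum is taken over a compact set. -/
theorem exists_isMin_pressure_zero (F : MoranFamily K 𝒜) (𝒬 : Measure 𝒜)
    [IsProbabilityMeasure 𝒬] :
    ∃ (d : ℝ) (p₀ : Weights K), IsValidWeight p₀ ∧ 0 < d ∧
      F.pressure 𝒬 (Measure.dirac p₀) d = 0 ∧
      ∀ p : Weights K, IsValidWeight p → ∀ α : ℝ, 0 < α →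
        F.pressure 𝒬 (Measure.dirac p) α = 0 → d ≤ α := by
  classical
  have := F.fin_nonempty
  have hex : ∀ p : Weights K, ∃ α : ℝ, IsValidWeight p →
      0 < α ∧ F.pressure 𝒬 (Measure.dirac p) α = 0 := by
    intro p
    by_cases hp : IsValidWeight p
    · obtain ⟨α, hα⟩ := F.exists_pressure_eq_zero 𝒬 hp.isAdmissible_dirac
      exact ⟨α, fun _ => hα⟩
    · exact ⟨0, fun h => absurd h hp⟩
  choose a ha using hex
  have huniq : ∀ p : Weights K, IsValidWeight p → ∀ α : ℝ, 0 < α →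
      F.pressure 𝒬 (Measure.dirac p) α = 0 → α = a p := fun p hp α hα hα0 =>
    le_antisymm
      (F.le_of_pressure_nonneg hp.isAdmissible_dirac (ha p hp).1.le (ha p hp).2.le hα0.ge)
      (F.le_of_pressure_nonneg hp.isAdmissible_dirac hα.le hα0.le (ha p hp).2.ge)
  have hK : (0 : ℝ) < K := by exact_mod_cast (by have := F.two_le; omega : 0 < K)
  let p₁ : Weights K := ⟨fun _ => (K : ℝ)⁻¹, fun _ => (inv_pos.2 hK).le, by simp [hK.ne']⟩
  have hp₁ : IsValidWeight p₁ := fun _ => (inv_pos.2 hK).ne'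
  have hc0 : 0 < F.A ^ a p₁ := Real.rpow_pos_of_pos F.A_pos _
  have hvalid : ∀ p : Weights K, (∀ i, F.A ^ a p₁ ≤ p i) → IsValidWeight p := fun p hp i =>
    (hc0.trans_le (hp i)).ne'
  have hcompact : IsCompact {p : Weights K | ∀ i, F.A ^ a p₁ ≤ p i} := by
    refine IsClosed.isCompact ?_
    simp only [Set.ofPred_forall]
    exact isClosed_iInter fun i => isClosed_le continuous_const (continuous_weight_apply i)
  have hcont : ContinuousOn a {p : Weights K | ∀ i, F.A ^ a p₁ ≤ p i} := by
    intro p hp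
    have hpv := hvalid p hp
    refine Metric.tendsto_nhds.2 fun ε hε => ?_
    have hδ : 0 < ε / 2 * -Real.log F.B := mul_pos (half_pos hε) (neg_pos.2 F.log_B_neg)
    have hclose : ∀ᶠ q in 𝓝 p, ∀ i, dist (Real.log (q i)) (Real.log (p i)) <
        ε / 2 * -Real.log F.B :=
      eventually_all.2 fun i => Metric.tendsto_nhds.1
        (((continuous_weight_apply i).continuousAt).log (hpv i)) _ hδ
    filter_upwards [mem_nhdsWithin_of_mem_nhds hclose, self_mem_nhdsWithin] with q hq hqK
    have hqv := hvalid q hqK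
    have h1 := F.pressure_zero_le_add hpv hqv (ha p hpv).1 (ha p hpv).2 (ha q hqv).2
      (half_pos hε).le fun i => by
        have := (abs_lt.1 (hq i)).1
        linarith
    have h2 := F.pressure_zero_le_add hqv hpv (ha q hqv).1 (ha q hqv).2 (ha p hpv).2
      (half_pos hε).le fun i => by
        have := (abs_lt.1 (hq i)).2
        linarith
    rw [Real.dist_eq, abs_lt]
    constructor <;> linarith
  obtain ⟨p₀, hp₀, hmin⟩ := hcompact.exists_isMinOn
    ⟨p₁, F.rpow_le_weight hp₁ (ha p₁ hp₁).1 (ha p₁ hp₁).2⟩ hcont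
  have hp₀v := hvalid p₀ hp₀
  have hmin₁ : a p₀ ≤ a p₁ := hmin (F.rpow_le_weight hp₁ (ha p₁ hp₁).1 (ha p₁ hp₁).2)
  refine ⟨a p₀, p₀, hp₀v, (ha p₀ hp₀v).1, (ha p₀ hp₀v).2, fun p hp α hα hα0 => ?_⟩
  rw [huniq p hp α hα hα0]
  by_contra! hlt
  refine absurd (hmin (show ∀ i, F.A ^ a p₁ ≤ p i from fun i => ?_)) (not_le.2 hlt)
  exact (Real.rpow_le_rpow_of_exponent_ge F.A_pos F.A_lt_one.le (hlt.le.trans hmin₁)).trans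
    (F.rpow_le_weight hp (ha p hp).1 (ha p hp).2 i)

end MoranFamily

theorem mainTheorem10 {K : ℕ} {𝒜 : Type*} [MeasurableSpace 𝒜] (F : MoranFamily K 𝒜)
    (𝒬 : Measure 𝒜) [IsProbabilityMeasure 𝒬] :
    -- the almost sure upper dimension exists for every admissible distribution of the weights
    (∀ ℛ : Measure (Weights K), IsAdmissible ℛ →
      ∃ α : ℝ, ∀ Φ : ℝ → ℝ, IsLargeDimensionFunction Φ → F.HasUpperDim 𝒬 ℛ Φ α) ∧
    -- and its infimum, over single vectors and over all distributions, is attained at a single one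
    ∃ (d : ℝ) (p₀ : Weights K), IsValidWeight p₀ ∧
      ∀ Φ : ℝ → ℝ, IsLargeDimensionFunction Φ →
        F.HasUpperDim 𝒬 (Measure.dirac p₀) Φ d ∧
        IsGLB {α : EReal | ∃ p : Weights K, IsValidWeight p ∧
          F.HasUpperDim 𝒬 (Measure.dirac p) Φ α} d ∧
        IsGLB {α : EReal | ∃ ℛ : Measure (Weights K), IsAdmissible ℛ ∧
          F.HasUpperDim 𝒬 ℛ Φ α} d := by
  refine ⟨fun ℛ hℛ => ?_, ?_⟩
  · obtain ⟨α, hα, hα0⟩ := F.exists_pressure_eq_zero 𝒬 hℛ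
    exact ⟨α, fun Φ hΦ => F.hasUpperDim_of_pressure_eq_zero hℛ hα hα0 hΦ⟩
  obtain ⟨d, p₀, hp₀, hd, hd0, hmin⟩ := F.exists_isMin_pressure_zero 𝒬
  refine ⟨d, p₀, hp₀, fun Φ hΦ => ?_⟩
  have hdim := F.hasUpperDim_of_pressure_eq_zero hp₀.isAdmissible_dirac hd hd0 hΦ
  have hlower : ∀ ℛ : Measure (Weights K), IsAdmissible ℛ → ∀ α : EReal,
      F.HasUpperDim 𝒬 ℛ Φ α → d ≤ α := by
    intro ℛ hℛ α hα
    have := hℛ.1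
    obtain ⟨β, hβ, hβ0⟩ := F.exists_pressure_eq_zero 𝒬 hℛ
    rw [hα.unique (F.hasUpperDim_of_pressure_eq_zero hℛ hβ hβ0 hΦ), EReal.coe_le_coe_iff]
    obtain ⟨p, hp, hle⟩ := F.exists_pressure_dirac_le 𝒬 hℛ
    obtain ⟨γ, hγ, hγ0⟩ := F.exists_pressure_eq_zero 𝒬 hp.isAdmissible_dirac
    exact (hmin p hp γ hγ hγ0).trans (F.le_of_pressure_nonneg hp.isAdmissible_dirac hβ.le
      ((hle β hβ.le).trans hβ0.le) hγ0.ge)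
  refine ⟨hdim, ⟨?_, fun b hb => hb ⟨p₀, hp₀, hdim⟩⟩,
    ⟨?_, fun b hb => hb ⟨_, hp₀.isAdmissible_dirac, hdim⟩⟩⟩
  · rintro α ⟨p, hp, hα⟩
    exact hlower _ hp.isAdmissible_dirac α hα
  · rintro α ⟨ℛ, hℛ, hα⟩
    exact hlower ℛ hℛ α hα
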